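/- **Notation.** Let $m_1,m_2,n\ge 1$ be integers, $m=m_1+m_2$, $j=\mathrm{diag}(I_{m_1},-I_{m_2})$. Let $A$ and $S_0>0$ be $n\times n$ complex matrices and let $\Pi_0=[\vartheta_1\ \ \vartheta_2]$ be an $n\times m$ complex matrix, where $\vartheta_1$ is $n\times m_1$. Assume that the triple $\{A,S_0,\Pi_0\}$ is strongly admissible, that is, $AS_0-S_0A^*=\mathrm i\,\Pi_0\Pi_0^*$, the pair $\{A,\vartheta_1\}$ is controllable (the columns of $\vartheta_1,A\vartheta_1,\dots,A^{n-1}\vartheta_1$ span $\mathbb C^n$), and $\mathrm i\notin\sigma(A)$. For $k\ge 0$ set $$\Pi_{k+1}=\Pi_k+\mathrm iA^{-1}\Pi_kj,\qquad S_{k+1}=S_k+A^{-1}S_k(A^*)^{-1}+A^{-1}\Pi_kj\Pi_k^*(A^*)^{-1},$$ $$C_k=j+\Pi_k^*S_k^{-1}\Pi_k-\Pi_{k+1}^*S_{k+1}^{-1}\Pi_{k+1}.$$ (Sequences $\{C_k\}$ obtained in this way are called strictly pseudo-exponential potentials.) Put $$w_A(0,\lambda)=I_m-\mathrm i\,\Pi_0^*S_0^{-1}(A-\lambda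 I_n)^{-1}\Pi_0=\begin{bmatrix}a(\lambda)&b(\lambda)\\ c(\lambda)&d(\lambda)\end{bmatrix}$$ with blocks partitioned as $j$. Consider the system $y_{k+1}(z)=\big(I_m+\tfrac{\mathrm i}{z}C_k\big)y_k(z)$, $k\ge0$, and let $w_k(z)$ be its fundamental solution, $w_0(z)=I_m$. * *Reflection coefficient.* If $Y_k(z)$ is the $m\times m_2$ matrix solution with $Y_k(z)=\big(1-\tfrac{\mathrm i}{z}\big)^k\big(\begin{bmatrix}0\\ I_{m_2}\end{bmatrix}+o(1)\big)$ as $k\to\infty$, then $\mathcal R(z)=[I_{m_1}\ \ 0]\,Y_0(z)\,\big([0\ \ I_{m_2}]\,Y_0(z)\big)^{-1}$, defined where the matrix in parentheses is invertible. * *Weyl function.* An $m_1\times m_2$ matrix function $\varphi$ on a half-plane $\{\Im z>M\}$, $M>0$, such that $\sum_{k=0}^\infty[\varphi(z)^*\ \ I_{m_2}]\,w_k(z)^*w_k(z)\begin{bmatrix}\varphi(z)\\ I_{m_2}\end{bmatrix}<\infty$ for all $z$ in this half-plane. **Theorem.** The potential is well defined ($\det A\ne0$ and $S_k>0$ for all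 $k$), and $C_k=U_k^*jU_k$ with unitary $U_k$, so that the system is a skew-self-adjoint discrete Dirac system. The expression $b(-z)d(-z)^{-1}$ is defined (that is, $-z\notin\sigma(A)$ and $\det d(-z)\ne0$) for all but finitely many $z\in\mathbb C$, and there is a rational $m_1\times m_2$ matrix function $F$, regular at all these points, with $F(z)=b(-z)d(-z)^{-1}$ there. Moreover: 1. For every $z$ with $\Im z\ge0$, $z\ne0,\mathrm i$ (in particular for every real $z\neq 0$), one has $-z\notin\sigma(A)$, the solution $Y_k(z)$ exists and is unique, $\mathcal R(z)$ is defined if and only if $\det d(-z)\neq0$, and in that case $\mathcal R(z)=F(z)$. 2. For some $M>0$, $b(-z)d(-z)^{-1}$ is defined for all $z$ with $\Im z>M$, and $F$ is a Weyl function on $\{\Im z>M\}$. Conversely, if $\varphi$ is a Weyl function on $\{\Im z>M\}$ for some $M>0$, then for every $z$ with $\Im z>M$ one has $-z\notin\sigma(A)$, $\det d(-z)\ne0$ and $\varphi(z)=F(z)$. Thus the reflection coefficient and the Weyl function are given by the same rational matrix function $b(-z)d(-z)^{-1}$, and the Weyl function is the analytic continuation of the reflection coefficient. -/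

import Mathlib

open scoped Matrix ComplexOrder

namespace SkewDirac

/-- Square matrices of order `m = m₁ + m₂`, in the block partition induced by `j`. -/
abbrev BlockMat (m₁ m₂ : ℕ) : Type :=
  Matrix (Fin m₁ ⊕ Fin m₂) (Fin m₁ ⊕ Fin m₂) ℂ

/-- The signature matrix `j = diag(I_{m₁}, -I_{m₂})`. -/
def sigJ (m₁ m₂ : ℕ) : BlockMat m₁ m₂ :=
  Matrix.fromBlocks 1 0 0 (-1)

/-- `C_k = U_k^* j U_k` with unitary `U_k`, for all `k ≥ 0`: the sequence `C` is the potential of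
a skew-self-adjoint discrete Dirac system. -/
def IsDiracPotential {m₁ m₂ : ℕ} (C : ℕ → BlockMat m₁ m₂) : Prop :=
  ∀ k, ∃ U ∈ Matrix.unitaryGroup (Fin m₁ ⊕ Fin m₂) ℂ, C k = Uᴴ * sigJ m₁ m₂ * U

/-- `Y` is a (matrix) solution of the system `y_{k+1} = (I + (i/z) C_k) y_k` at the value `z` of
the spectral parameter. -/
def IsSolution {m₁ m₂ p : ℕ} (C : ℕ → BlockMat m₁ m₂) (z : ℂ)
    (Y : ℕ → Matrix (Fin m₁ ⊕ Fin m₂) (Fin p) ℂ) : Prop :=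
  ∀ k, Y (k + 1) = (1 + (Complex.I / z) • C k) * Y k

/-- The fundamental solution `w_k(z)`, normalized by `w_0(z) = I_m`. -/
noncomputable def fundSol {m₁ m₂ : ℕ} (C : ℕ → BlockMat m₁ m₂) (z : ℂ) : ℕ → BlockMat m₁ m₂
  | 0 => 1
  | k + 1 => (1 + (Complex.I / z) • C k) * fundSol C z k

/-- `Y_k = (1 - i/z)^k ([0; I_{m₂}] + o(1))` as `k → ∞`. -/
def HasJostAsymptotics {m₁ m₂ : ℕ} (z : ℂ)
    (Y : ℕ → Matrix (Fin m₁ ⊕ Fin m₂) (Fin m₂) ℂ) : Prop :=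
  ∃ E : ℕ → Matrix (Fin m₁ ⊕ Fin m₂) (Fin m₂) ℂ,
    Filter.Tendsto E Filter.atTop (nhds (Matrix.fromRows 0 1)) ∧
      ∀ k, Y k = (1 - Complex.I / z) ^ k • E k

/-- `Y` is a solution of the system at `z` with the asymptotics `(1 - i/z)^k ([0; I] + o(1))`. -/
def IsJostSolution {m₁ m₂ : ℕ} (C : ℕ → BlockMat m₁ m₂) (z : ℂ)
    (Y : ℕ → Matrix (Fin m₁ ⊕ Fin m₂) (Fin m₂) ℂ) : Prop :=
  IsSolution C z Y ∧ HasJostAsymptotics z Y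

/-- The reflection coefficient is defined at `z` and has the value `ρ` there:
`ρ = [I 0] Y_0(z) ([0 I] Y_0(z))⁻¹`, the matrix in parentheses being invertible. -/
def IsReflectionValue {m₁ m₂ : ℕ} (C : ℕ → BlockMat m₁ m₂) (z : ℂ)
    (ρ : Matrix (Fin m₁) (Fin m₂) ℂ) : Prop :=
  ∃ Y, IsJostSolution C z Y ∧ IsUnit (Y 0).toRows₂ ∧ ρ = (Y 0).toRows₁ * ((Y 0).toRows₂)⁻¹

/-- `φ` is a Weyl function of the system in the half-plane `Im z > M`, `M > 0`. -/
def IsWeylFunction {m₁ m₂ : ℕ} (C : ℕ → BlockMat m₁ m₂) (M : ℝ)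
    (φ : ℂ → Matrix (Fin m₁) (Fin m₂) ℂ) : Prop :=
  0 < M ∧ ∀ z : ℂ, M < z.im →
    Summable fun k : ℕ =>
      (Matrix.fromRows (φ z) (1 : Matrix (Fin m₂) (Fin m₂) ℂ))ᴴ * (fundSol C z k)ᴴ *
        fundSol C z k * Matrix.fromRows (φ z) (1 : Matrix (Fin m₂) (Fin m₂) ℂ)

/-- Controllability of the pair `{A, B}`: the columns of `B, A B, …, A^{n-1} B` span `ℂⁿ`. -/
def Controllable {n p : ℕ} (A : Matrix (Fin n) (Fin n) ℂ) (B : Matrix (Fin n) (Fin p) ℂ) : Prop :=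
  ⨆ k : Fin n, LinearMap.range (A ^ (k : ℕ) * B).mulVecLin = ⊤

/-- A triple `{A, S₀, Π₀}` of parameter matrices (`P₀` stands for `Π₀`). -/
structure Triple (m₁ m₂ n : ℕ) where
  A : Matrix (Fin n) (Fin n) ℂ
  S₀ : Matrix (Fin n) (Fin n) ℂ
  P₀ : Matrix (Fin n) (Fin m₁ ⊕ Fin m₂) ℂ

namespace Triple

variable {m₁ m₂ n : ℕ} (T : Triple m₁ m₂ n)

/-- Strong admissibility: `S₀ > 0`, `A S₀ - S₀ A^* = i Π₀ Π₀^*`, the pair `{A, ϑ₁}` is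
controllable, where `ϑ₁` consists of the first `m₁` columns of `Π₀`, and `i ∉ σ(A)`. -/
structure StronglyAdmissible : Prop where
  posDef : T.S₀.PosDef
  identity : T.A * T.S₀ - T.S₀ * T.Aᴴ = Complex.I • (T.P₀ * T.P₀ᴴ)
  controllable : Controllable T.A T.P₀.toCols₁
  not_mem_spectrum : Complex.I ∉ spectrum ℂ T.A

/-- `Π_{k+1} = Π_k + i A⁻¹ Π_k j`. -/
noncomputable def P : ℕ → Matrix (Fin n) (Fin m₁ ⊕ Fin m₂) ℂ
  | 0 => T.P₀
  | k + 1 => P k + Complex.I • (T.A⁻¹ * P k * sigJ m₁ m₂)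

/-- `S_{k+1} = S_k + A⁻¹ S_k (A^*)⁻¹ + A⁻¹ Π_k j Π_k^* (A^*)⁻¹`. -/
noncomputable def S : ℕ → Matrix (Fin n) (Fin n) ℂ
  | 0 => T.S₀
  | k + 1 => S k + T.A⁻¹ * S k * (T.Aᴴ)⁻¹ +
      T.A⁻¹ * T.P k * sigJ m₁ m₂ * (T.P k)ᴴ * (T.Aᴴ)⁻¹

/-- The potential determined by the triple:
`C_k = j + Π_k^* S_k⁻¹ Π_k - Π_{k+1}^* S_{k+1}⁻¹ Π_{k+1}`. The potentials determined by strongly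
admissible triples (with `n > 0`) are the strictly pseudo-exponential ones. -/
noncomputable def potential (k : ℕ) : BlockMat m₁ m₂ :=
  sigJ m₁ m₂ + (T.P k)ᴴ * (T.S k)⁻¹ * T.P k - (T.P (k + 1))ᴴ * (T.S (k + 1))⁻¹ * T.P (k + 1)

/-- The transfer matrix function `w_A(k, lam) = I - i Π_k^* S_k⁻¹ (A - lam I)⁻¹ Π_k`. -/
noncomputable def transfer (k : ℕ) (lam : ℂ) : BlockMat m₁ m₂ :=
  1 - Complex.I • ((T.P k)ᴴ * (T.S k)⁻¹ * (T.A - lam • 1)⁻¹ * T.P k)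

/-- The upper right block of `w_A(0, lam)`. -/
noncomputable def b (lam : ℂ) : Matrix (Fin m₁) (Fin m₂) ℂ :=
  (T.transfer 0 lam).toBlocks₁₂

/-- The lower right block of `w_A(0, lam)`. -/
noncomputable def d (lam : ℂ) : Matrix (Fin m₂) (Fin m₂) ℂ :=
  (T.transfer 0 lam).toBlocks₂₂

end Triple

/-- A rational matrix function is a matrix over `ℂ(z)`; it is regular at `z` if no denominator (of
an entry in lowest terms) vanishes there. -/
def RegularAt {p q : ℕ} (F : Matrix (Fin p) (Fin q) (RatFunc ℂ)) (z : ℂ) : Prop :=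
  ∀ i l, (F i l).denom.eval z ≠ 0

/-- The value of a rational matrix function at a point where it is regular. -/
noncomputable def ratEval {p q : ℕ} (F : Matrix (Fin p) (Fin q) (RatFunc ℂ)) (z : ℂ) :
    Matrix (Fin p) (Fin q) ℂ :=
  F.map (RatFunc.eval (RingHom.id ℂ) z)

end SkewDirac

/-!
Let `e = I + j`, `D = (A - i)⁻¹` and `Q = I - i A⁻¹`. The Lyapunov identity and controllability
put the spectrum of `A` in the open upper half-plane (`StronglyAdmissible.im_pos`). Dividing by
powers of `Q`, that is, writing `Π_k = Q^k V_k` and `S_k = Q^k R_k Q^{k*}`, turns the recursion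
into `V_{k+1} = V_k + i D V_k e`, `R_{k+1} = R_k + D V_k e V_k^* D^*`. Hence `R_k`, and so `S_k`,
is positive definite, the second block of columns of `V_k` is constant, and `A R_k - R_k A^* = i
V_k V_k^*` persists. The transfer functions `w_A(k, lam)` and the potential can be expressed by
`V_k` and `R_k`.

*Darboux transformation* (`darboux`). One has `w_A(k+1, -z) (I + (i/z) j) = (I + (i/z) C_k) w_A(k,
-z)`. Since `w_A(k, ·)` is unitary on the real axis, `C_k² = I`; the trace of `Π_k^* S_k⁻¹ Π_k`
depends on `A` only, so `C_k` has the trace of `j` and is unitarily equivalent to `j`.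

*Asymptotics*. Controllability forces `R_k` to infinity (`exists_le_quadR`), and the Lyapunov
identity then gives `V_k^* R_k⁻¹ v → 0` for each fixed `v` (`tendsto_V_mulVec`). Therefore the
last `m₂` columns of `w_A(k, -z)` tend to those of `I`, which makes `(1 - i/z)^k w_A(k, -z) [0;
I]` the Jost solution, with initial value `[b(-z); d(-z)]`; moreover `C_k → j`
(`tendsto_potential`). In the closed upper half-plane each step of the system multiplies norms at
least by `|1 - i/z|`, so that the Jost solution is unique (`IsJostSolution.unique`).

*Weyl functions*. For `Im z > 1/2` one has `|1 - i/z| < 1`, and `[b d⁻¹; I] = [b; d] d⁻¹`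
generates a square summable solution. Conversely, if a solution `y_k` has `y_k^* C_k y_k ≥ 0` at
some large `k`, then it has so forever, because consecutive `C_k` are close, and its norm does not
decrease (`fundSol_mulVec_eq_zero`). So the form is negative on decaying solutions, which span a
space of dimension at most `m₂`, filled by the Jost solution (`exists_of_tendsto_of_ne`). The
point `z = i`, where the system is singular, is handled through the invertibility of `w_A(0, -i)`
(`exists_of_tendsto_I`); this uses that `i` is not in the spectrum of `A`.
-/

namespace SkewDirac

open Filter Topology

/-! ### Vectors and the Darboux transformation -/

section Vectors
variable {ι κ : Type*} [Fintype ι] [Fintype κ]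

/-- The squared Euclidean norm of a complex vector. -/
noncomputable def normSq (v : ι → ℂ) : ℝ := ∑ i, ‖v i‖ ^ 2

theorem star_dotProduct_self (v : ι → ℂ) : star v ⬝ᵥ v = (normSq v : ℂ) := by
  simp [dotProduct, normSq, Complex.conj_mul']

theorem normSq_nonneg (v : ι → ℂ) : 0 ≤ normSq v := Finset.sum_nonneg fun _ _ => by positivity

@[simp] theorem normSq_zero : normSq (0 : ι → ℂ) = 0 := by simp [normSq]

theorem normSq_eq_zero {v : ι → ℂ} : normSq v = 0 ↔ v = 0 := by
  simp [normSq, Finset.sum_eq_zero_iff_of_nonneg, funext_iff]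

theorem sq_norm_apply_le_normSq (v : ι → ℂ) (i : ι) : ‖v i‖ ^ 2 ≤ normSq v :=
  Finset.single_le_sum (f := fun i => ‖v i‖ ^ 2) (fun _ _ => by positivity) (Finset.mem_univ i)

theorem normSq_smul (c : ℂ) (v : ι → ℂ) : normSq (c • v) = ‖c‖ ^ 2 * normSq v := by
  simp [normSq, mul_pow, Finset.mul_sum]

theorem continuous_normSq : Continuous (normSq : (ι → ℂ) → ℝ) := by
  unfold normSq; fun_prop

/-- The arithmetic-geometric form of the Cauchy–Schwarz inequality, with a weight `t`. -/
theorem two_mul_norm_dotProduct_le (u v : ι → ℂ) {t : ℝ} (ht : 0 < t) :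
    2 * ‖star u ⬝ᵥ v‖ ≤ t * normSq u + t⁻¹ * normSq v := by
  have h : ‖star u ⬝ᵥ v‖ ≤ ∑ i, ‖u i‖ * ‖v i‖ := by
    refine (norm_sum_le _ _).trans (le_of_eq ?_)
    simp
  refine (mul_le_mul_of_nonneg_left h zero_le_two).trans ?_
  rw [normSq, normSq, Finset.mul_sum, Finset.mul_sum, Finset.mul_sum, ← Finset.sum_add_distrib]
  refine Finset.sum_le_sum fun i _ => ?_
  have h2 : t * ‖u i‖ ^ 2 + t⁻¹ * ‖v i‖ ^ 2 - 2 * (‖u i‖ * ‖v i‖)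
      = t⁻¹ * (t * ‖u i‖ - ‖v i‖) ^ 2 := by field_simp; ring
  have : 0 ≤ t⁻¹ * (t * ‖u i‖ - ‖v i‖) ^ 2 := by positivity
  linarith

/-- The sum of the absolute values of the entries of a matrix bounds its quadratic form. -/
theorem norm_quadForm_le (M : Matrix ι ι ℂ) (v : ι → ℂ) :
    ‖star v ⬝ᵥ M *ᵥ v‖ ≤ (∑ i, ∑ l, ‖M i l‖) * normSq v := by
  simp only [dotProduct, Matrix.mulVec, Finset.mul_sum, Finset.sum_mul]
  refine (norm_sum_le _ _).trans (Finset.sum_le_sum fun i _ => ?_)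
  refine (norm_sum_le _ _).trans (Finset.sum_le_sum fun l _ => ?_)
  have h1 := sq_norm_apply_le_normSq v i
  have h2 := sq_norm_apply_le_normSq v l
  have h3 : ‖v i‖ * ‖v l‖ ≤ normSq v := by nlinarith [sq_nonneg (‖v i‖ - ‖v l‖)]
  calc _ = ‖M i l‖ * (‖v i‖ * ‖v l‖) := by simp; ring
    _ ≤ _ := by gcongr

theorem normSq_mulVec (M : Matrix κ ι ℂ) (v : ι → ℂ) :
    (normSq (M *ᵥ v) : ℂ) = star v ⬝ᵥ (Mᴴ * M) *ᵥ v := by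
  rw [← star_dotProduct_self, Matrix.star_mulVec, ← Matrix.mulVec_mulVec,
    Matrix.dotProduct_mulVec (star v)]

theorem tendsto_zero_of_normSq {α : Type*} {l : Filter α} {f : α → ι → ℂ}
    (h : Filter.Tendsto (fun k => normSq (f k)) l (nhds 0)) : Filter.Tendsto f l (nhds 0) := by
  refine tendsto_pi_nhds.2 fun i => ?_
  rw [Pi.zero_apply, tendsto_zero_iff_norm_tendsto_zero]
  have h2 : Filter.Tendsto (fun k => ‖f k i‖ ^ 2) l (nhds 0) :=
    squeeze_zero (fun _ => by positivity) (fun k => sq_norm_apply_le_normSq (f k) i) h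
  simpa using h2.sqrt

end Vectors

section Algebra
variable {ι κ : Type*} [Fintype ι] [DecidableEq ι] [Fintype κ] [DecidableEq κ]
variable {A D R : Matrix ι ι ℂ} {V : Matrix ι κ ℂ} {J : Matrix κ κ ℂ}

/-- The Lyapunov identity passes from `(R_k, V_k)` to `(R_{k+1}, V_{k+1})`. -/
theorem lyapunov_step (hD : A * D = 1 + Complex.I • D) (hJ : J * J = 1) (hJH : Jᴴ = J)
    (h : A * R - R * Aᴴ = Complex.I • (V * Vᴴ)) :
    A * (R + D * V * (1 + J) * Vᴴ * Dᴴ) - (R + D * V * (1 + J) * Vᴴ * Dᴴ) * Aᴴ =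
      Complex.I • ((V + Complex.I • (D * V * (1 + J))) * (V + Complex.I • (D * V * (1 + J)))ᴴ) := by
  have hD' : Dᴴ * Aᴴ = 1 - Complex.I • Dᴴ := by
    rw [← Matrix.conjTranspose_mul, hD]; simp [sub_eq_add_neg]
  have h1 : ∀ M : Matrix ι ι ℂ, A * (D * M) = M + Complex.I • (D * M) := fun M => by
    rw [← Matrix.mul_assoc, hD, Matrix.add_mul, Matrix.one_mul, Matrix.smul_mul]
  have h2 : ∀ M : Matrix κ ι ℂ, J * (J * M) = M := fun M => by
    rw [← Matrix.mul_assoc, hJ, Matrix.one_mul]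
  simp only [Matrix.conjTranspose_add, Matrix.conjTranspose_smul, Matrix.conjTranspose_mul, hJH,
    Matrix.mul_add, Matrix.add_mul, Matrix.mul_assoc, Matrix.smul_mul, Matrix.mul_smul, h1, hD',
    Matrix.mul_one, smul_add, smul_smul, Matrix.mul_sub, h2,
    Complex.star_def, Complex.conj_I, Complex.I_mul_I, mul_neg, neg_mul, neg_neg]
  linear_combination (norm := module) h

/-- The intertwining relation `i C X = X A - X₊ (A + i)` behind the Darboux transformation. -/
theorem darboux_core {R' : Matrix ι ι ℂ} (hD : (A - Complex.I • 1) * D = 1) (hR : IsUnit R)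
    (hR' : IsUnit R') (hJH : Jᴴ = J)
    (h : A * R - R * Aᴴ = Complex.I • (V * Vᴴ)) {V' : Matrix ι κ ℂ}
    (hV' : V' = V + Complex.I • (D * V * (1 + J)))
    (hRR : R' = R + D * V * (1 + J) * Vᴴ * Dᴴ) :
    Complex.I • ((J + Vᴴ * R⁻¹ * V - V'ᴴ * R'⁻¹ * V') * (Vᴴ * R⁻¹)) =
      Vᴴ * R⁻¹ * A - V'ᴴ * R'⁻¹ * (A + Complex.I • 1) := by
  have hDH : Dᴴ * (Aᴴ + Complex.I • 1) = 1 := by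
    have := congrArg Matrix.conjTranspose hD
    simpa [Matrix.conjTranspose_mul, sub_eq_add_neg] using this
  have hDA : Dᴴ * Aᴴ = 1 - Complex.I • Dᴴ := by
    rw [← hDH, Matrix.mul_add, Matrix.mul_smul, Matrix.mul_one, add_sub_cancel_right]
  have hR1 : R⁻¹ * R = 1 := Matrix.nonsing_inv_mul _ ((Matrix.isUnit_iff_isUnit_det _).1 hR)
  have hR2 : R * R⁻¹ = 1 := Matrix.mul_nonsing_inv _ ((Matrix.isUnit_iff_isUnit_det _).1 hR)
  have hR3 : R'⁻¹ * R' = 1 := Matrix.nonsing_inv_mul _ ((Matrix.isUnit_iff_isUnit_det _).1 hR')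
  -- the relation `R₊ (A^* + i) = (A + i) R - i V₊ V^*`
  have k1 : R' * (Aᴴ + Complex.I • 1) = (A + Complex.I • 1) * R - Complex.I • (V' * Vᴴ) := by
    rw [hRR, Matrix.add_mul, Matrix.mul_assoc _ Dᴴ, hDH, hV']
    simp only [Matrix.mul_add, Matrix.add_mul, Matrix.smul_mul, Matrix.mul_smul, Matrix.mul_one,
      Matrix.one_mul, smul_add, smul_smul, Complex.I_mul_I, Matrix.mul_assoc]
    linear_combination (norm := module) -h
  have k2 : V'ᴴ * (Aᴴ + Complex.I • 1) = Vᴴ * Aᴴ - Complex.I • (J * Vᴴ) := by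
    rw [hV']
    simp only [Matrix.conjTranspose_add, Matrix.conjTranspose_smul, Matrix.conjTranspose_mul, hJH,
      Matrix.add_mul, Matrix.smul_mul, Matrix.mul_assoc, hDA, Matrix.mul_one, Matrix.mul_sub,
      Complex.star_def, Complex.conj_I, smul_add, Matrix.mul_add, Matrix.mul_smul, smul_sub,
      smul_smul,
      mul_neg, neg_mul, neg_neg, Complex.I_mul_I]
    module
  have k3 : V'ᴴ * R'⁻¹ * ((A + Complex.I • 1) * R - Complex.I • (V' * Vᴴ)) =
      Vᴴ * Aᴴ - Complex.I • (J * Vᴴ) := by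
    rw [← k1, ← k2, Matrix.mul_assoc, ← Matrix.mul_assoc R'⁻¹, hR3, Matrix.one_mul]
  have k4 : Vᴴ * R⁻¹ * (A * R - R * Aᴴ) = Complex.I • (Vᴴ * R⁻¹ * V * Vᴴ) := by
    rw [h, Matrix.mul_smul]; simp only [Matrix.mul_assoc]
  rw [Matrix.mul_sub, Matrix.mul_assoc Vᴴ R⁻¹ (R * Aᴴ), ← Matrix.mul_assoc R⁻¹ R, hR1,
    Matrix.one_mul] at k4
  have k5 : Complex.I • ((J + Vᴴ * R⁻¹ * V - V'ᴴ * R'⁻¹ * V') * Vᴴ) =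
      (Vᴴ * R⁻¹ * A - V'ᴴ * R'⁻¹ * (A + Complex.I • 1)) * R := by
    rw [Matrix.mul_sub] at k3
    simp only [Matrix.sub_mul, Matrix.add_mul, Matrix.mul_add, Matrix.mul_smul, Matrix.mul_assoc,
      Matrix.smul_mul, Matrix.one_mul] at k3 k4 ⊢
    linear_combination (norm := module) k3 - k4
  rw [← Matrix.mul_assoc, ← Matrix.smul_mul, k5, Matrix.mul_assoc, hR2, Matrix.mul_one]

/-- The Darboux transformation intertwines the systems with potentials `J` and `C`; the spectral
parameter is cleared of denominators. -/
theorem darboux {R' : Matrix ι ι ℂ} (hD : (A - Complex.I • 1) * D = 1) (hR : IsUnit R)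
    (hR' : IsUnit R') (hJ : J * J = 1) (hJH : Jᴴ = J)
    (h : A * R - R * Aᴴ = Complex.I • (V * Vᴴ)) {V' : Matrix ι κ ℂ}
    (hV' : V' = V + Complex.I • (D * V * (1 + J)))
    (hRR : R' = R + D * V * (1 + J) * Vᴴ * Dᴴ) {lam : ℂ} (hl : IsUnit (A - lam • 1)) :
    (1 - Complex.I • (V'ᴴ * R'⁻¹ * (A - lam • 1)⁻¹ * V')) * (lam • 1 - Complex.I • J) =
      (lam • 1 - Complex.I • (J + Vᴴ * R⁻¹ * V - V'ᴴ * R'⁻¹ * V')) *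
        (1 - Complex.I • (Vᴴ * R⁻¹ * (A - lam • 1)⁻¹ * V)) := by
  have core := darboux_core hD hR hR' hJH h hV' hRR
  set C := J + Vᴴ * R⁻¹ * V - V'ᴴ * R'⁻¹ * V' with hC
  set X := Vᴴ * R⁻¹
  set X' := V'ᴴ * R'⁻¹
  set B := (A - lam • 1)⁻¹
  have hB1 : B * (A - lam • 1) = 1 :=
    Matrix.nonsing_inv_mul _ ((Matrix.isUnit_iff_isUnit_det _).1 hl)
  have hB2 : (A - lam • 1) * B = 1 :=
    Matrix.mul_nonsing_inv _ ((Matrix.isUnit_iff_isUnit_det _).1 hl)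
  have hJJ : (1 + J) * (lam • 1 - Complex.I • J) = (lam - Complex.I) • (1 + J) := by
    simp only [Matrix.mul_sub, Matrix.add_mul, Matrix.mul_smul, hJ, Matrix.one_mul, Matrix.mul_one]
    module
  have hcomm : (lam - Complex.I) • D = 1 - (A - lam • 1) * D := by
    have : (A - lam • 1) * D = (A - Complex.I • 1) * D + (Complex.I - lam) • D := by
      simp only [Matrix.sub_mul, Matrix.smul_mul, Matrix.one_mul]; module
    rw [this, hD]; module
  have e1 : V' * (lam • 1 - Complex.I • J) =
      (lam + Complex.I) • V - Complex.I • ((A - lam • 1) * (D * V * (1 + J))) := by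
    rw [hV', Matrix.add_mul, Matrix.smul_mul, Matrix.mul_assoc (D * V), hJJ, Matrix.mul_smul,
      ← Matrix.smul_mul (lam - Complex.I), ← Matrix.smul_mul (lam - Complex.I), hcomm]
    simp only [Matrix.mul_sub, Matrix.sub_mul, Matrix.mul_add, Matrix.mul_smul, Matrix.smul_mul,
      Matrix.one_mul, Matrix.mul_one, Matrix.mul_assoc]
    module
  have e2 : B * (V' * (lam • 1 - Complex.I • J)) =
      (lam + Complex.I) • (B * V) - Complex.I • (D * V * (1 + J)) := by
    rw [e1, Matrix.mul_sub, Matrix.mul_smul, Matrix.mul_smul, ← Matrix.mul_assoc B, hB1,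
      Matrix.one_mul]
  have e3 : X' * V' = X' * V + Complex.I • (X' * (D * V * (1 + J))) := by
    rw [← Matrix.mul_smul, ← Matrix.mul_add, ← hV']
  have hVB : V = A * (B * V) - lam • (B * V) := by
    conv_lhs => rw [← Matrix.one_mul V, ← hB2, Matrix.mul_assoc, Matrix.sub_mul, Matrix.smul_mul,
      Matrix.one_mul]
  have e4 : X * V = X * (A * (B * V)) - lam • (X * (B * V)) := by
    conv_lhs => rw [hVB, Matrix.mul_sub, Matrix.mul_smul]
  have e5 : X' * V = X' * (A * (B * V)) - lam • (X' * (B * V)) := by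
    conv_lhs => rw [hVB, Matrix.mul_sub, Matrix.mul_smul]
  have core2 := congrArg (fun M => M * (B * V)) core
  simp only [Matrix.smul_mul, Matrix.sub_mul, Matrix.mul_add, Matrix.mul_smul, Matrix.mul_one,
    Matrix.add_mul, Matrix.mul_assoc] at core2
  rw [Matrix.sub_mul, Matrix.one_mul, Matrix.smul_mul, Matrix.mul_assoc, Matrix.mul_assoc, e2]
  simp only [Matrix.smul_mul, Matrix.sub_mul, Matrix.mul_add, Matrix.mul_smul, Matrix.mul_one,
    Matrix.mul_assoc, Matrix.one_mul, Matrix.mul_sub, smul_sub, smul_add, smul_smul]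
    at core2 e3 e4 e5 ⊢
  have e6 : J = C - X * V + X' * V' := by rw [hC]; abel
  linear_combination (norm := module) Complex.I • e4 - Complex.I • e6 - Complex.I • e3
    - Complex.I • e5 - Complex.I • core2

end Algebra

/-! ### Transfer functions and Hermitian involutions -/

section Realization
variable {ι κ : Type*} [Fintype ι] [DecidableEq ι] [Fintype κ] [DecidableEq κ]

/-- The transfer function `I - i V^* R⁻¹ (A - lam)⁻¹ V` determined by matrices `A`, `R`, `V`. -/
noncomputable def realization (A R : Matrix ι ι ℂ) (V : Matrix ι κ ℂ) (lam : ℂ) : Matrix κ κ ℂ :=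
  1 - Complex.I • (Vᴴ * R⁻¹ * (A - lam • 1)⁻¹ * V)

variable {A R : Matrix ι ι ℂ} {V : Matrix ι κ ℂ}

/-- By the Lyapunov identity, the transfer function is inverted by its adjoint at the conjugate
point; in particular it is unitary on the real axis. -/
theorem realization_mul_conjTranspose (hR : R.PosDef)
    (h : A * R - R * Aᴴ = Complex.I • (V * Vᴴ)) {lam μ : ℂ} (hμ : μ = star lam)
    (hl : IsUnit (A - lam • 1)) (hm : IsUnit (A - μ • 1)) :
    realization A R V lam * (realization A R V μ)ᴴ = 1 := by
  have hRu : IsUnit R.det := (Matrix.isUnit_iff_isUnit_det _).1 hR.isUnit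
  have hR1 : R⁻¹ * R = 1 := Matrix.nonsing_inv_mul _ hRu
  have hR2 : R * R⁻¹ = 1 := Matrix.mul_nonsing_inv _ hRu
  have hRH : (R⁻¹)ᴴ = R⁻¹ := hR.inv.isHermitian
  set B := (A - lam • 1)⁻¹ with hBdef
  set E := ((A - μ • 1)⁻¹)ᴴ with hEdef
  have hB1 : B * (A - lam • 1) = 1 :=
    Matrix.nonsing_inv_mul _ ((Matrix.isUnit_iff_isUnit_det _).1 hl)
  have hE2 : (Aᴴ - lam • 1) * E = 1 := by
    have := congrArg Matrix.conjTranspose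
      (Matrix.nonsing_inv_mul _ ((Matrix.isUnit_iff_isUnit_det _).1 hm))
    simpa [Matrix.conjTranspose_mul, hμ, hEdef] using this
  have hBA : B * A = 1 + lam • B := by
    rw [← hB1, Matrix.mul_sub, Matrix.mul_smul, Matrix.mul_one]; abel
  have hAE : Aᴴ * E = 1 + lam • E := by
    rw [← hE2, Matrix.sub_mul, Matrix.smul_mul, Matrix.one_mul]; abel
  -- the Lyapunov identity, multiplied by the resolvents
  have key : R * E - B * R = Complex.I • (B * (V * (Vᴴ * E))) := by
    have := congrArg (fun M => B * M * E) h
    simp only [Matrix.mul_sub, Matrix.sub_mul, ← Matrix.mul_assoc, hBA, Matrix.mul_smul,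
      Matrix.smul_mul] at this
    simp only [Matrix.mul_assoc, hAE, Matrix.add_mul, Matrix.one_mul, Matrix.smul_mul,
      Matrix.mul_add, Matrix.mul_smul, Matrix.mul_one] at this
    rw [← this]; abel
  have key2 := congrArg (fun M => Vᴴ * R⁻¹ * M * R⁻¹ * V) key
  simp only [Matrix.mul_sub, Matrix.sub_mul, Matrix.mul_smul, Matrix.smul_mul] at key2
  rw [Matrix.mul_assoc Vᴴ R⁻¹ (R * E), ← Matrix.mul_assoc R⁻¹, hR1, Matrix.one_mul,
    ← Matrix.mul_assoc (Vᴴ * R⁻¹) B R, Matrix.mul_assoc _ R R⁻¹, hR2, Matrix.mul_one] at key2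
  unfold realization
  simp only [Matrix.conjTranspose_sub, Matrix.conjTranspose_smul, Matrix.conjTranspose_mul, hRH,
    Matrix.conjTranspose_one, Matrix.conjTranspose_conjTranspose, Complex.star_def,
    Complex.conj_I, ← hBdef, ← hEdef]
  simp only [Matrix.mul_sub, Matrix.sub_mul, Matrix.mul_smul, Matrix.smul_mul, Matrix.mul_one,
    Matrix.one_mul, Matrix.mul_assoc] at key2 ⊢
  linear_combination (norm := module) Complex.I • key2

omit [DecidableEq κ] in
/-- The trace of `V^* R⁻¹ V` depends on `A` only. -/
theorem trace_of_lyapunov (hR : IsUnit R) (h : A * R - R * Aᴴ = Complex.I • (V * Vᴴ)) :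
    (Vᴴ * R⁻¹ * V).trace = -Complex.I * (A.trace - Aᴴ.trace) := by
  have hRu : IsUnit R.det := (Matrix.isUnit_iff_isUnit_det _).1 hR
  have h1 : (R⁻¹ * (A * R - R * Aᴴ)).trace = A.trace - Aᴴ.trace := by
    rw [Matrix.mul_sub, Matrix.trace_sub, ← Matrix.mul_assoc, ← Matrix.mul_assoc,
      Matrix.trace_mul_cycle, Matrix.mul_nonsing_inv _ hRu, Matrix.nonsing_inv_mul _ hRu,
      Matrix.one_mul, Matrix.one_mul]
  rw [h, Matrix.mul_smul, Matrix.trace_smul, Matrix.trace_mul_comm, Matrix.mul_assoc,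
    Matrix.trace_mul_comm V, smul_eq_mul] at h1
  rw [← h1, ← mul_assoc]; simp

end Realization

section Involution
variable {m₁ m₂ : ℕ}

theorem sigJ_mul_self : sigJ m₁ m₂ * sigJ m₁ m₂ = 1 := by
  simp [sigJ, Matrix.fromBlocks_multiply]

theorem sigJ_conjTranspose : (sigJ m₁ m₂)ᴴ = sigJ m₁ m₂ := by
  simp [sigJ, Matrix.fromBlocks_conjTranspose]

theorem sigJ_eq_diagonal : sigJ m₁ m₂ = Matrix.diagonal (Sum.elim (fun _ => 1) (fun _ => -1)) := by
  have h : (Matrix.diagonal fun _ => -1 : Matrix (Fin m₂) (Fin m₂) ℂ) = -1 := by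
    rw [← Matrix.diagonal_one, ← Matrix.diagonal_neg]
  rw [← Matrix.fromBlocks_diagonal, h]
  simp [sigJ]

theorem trace_sigJ : (sigJ m₁ m₂).trace = (m₁ : ℂ) - m₂ := by
  simp [sigJ_eq_diagonal, sub_eq_add_neg]

/-- Hermitian involutions with the trace of `j` are unitarily equivalent to `j`. -/
theorem exists_unitary_of_involution {C : BlockMat m₁ m₂} (hC : Cᴴ = C) (hC2 : C * C = 1)
    (htr : C.trace = (m₁ : ℂ) - m₂) :
    ∃ U ∈ Matrix.unitaryGroup (Fin m₁ ⊕ Fin m₂) ℂ, C = Uᴴ * sigJ m₁ m₂ * U := by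
  classical
  have hH : C.IsHermitian := hC
  have hev : ∀ i, hH.eigenvalues i = 1 ∨ hH.eigenvalues i = -1 := by
    intro i
    have h1 := hH.mulVec_eigenvectorBasis i
    have h2 := congrArg (C *ᵥ ·) h1
    rw [Matrix.mulVec_mulVec, hC2, Matrix.one_mulVec, Matrix.mulVec_smul, h1, smul_smul] at h2
    have h3 : ((hH.eigenvalues i) * (hH.eigenvalues i) - 1) • (⇑(hH.eigenvectorBasis i)) = 0 := by
      rw [sub_smul, ← h2, one_smul, sub_self]
    have h4 : (hH.eigenvectorBasis i) ≠ 0 := hH.eigenvectorBasis.orthonormal.ne_zero i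
    rcases smul_eq_zero.1 h3 with h | h
    · have : (hH.eigenvalues i - 1) * (hH.eigenvalues i + 1) = 0 := by linarith
      rcases mul_eq_zero.1 this with h | h
      · left; linarith
      · right; linarith
    · exact absurd (by ext x; exact congrFun h x) h4
  let p : Fin m₁ ⊕ Fin m₂ → Prop := fun i => hH.eigenvalues i = 1
  have hsum : ∑ i, hH.eigenvalues i = (m₁ : ℝ) - m₂ := by
    have := hH.trace_eq_sum_eigenvalues
    rw [htr] at this
    have h2 : (((m₁ : ℝ) - m₂ : ℝ) : ℂ) = ((∑ i, hH.eigenvalues i : ℝ) : ℂ) := by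
      push_cast; simpa using this
    exact_mod_cast h2.symm
  have hval : ∀ i, hH.eigenvalues i = 2 * (if p i then 1 else 0) - 1 := by
    intro i
    by_cases h : p i
    · simp only [h, if_true]; rw [show hH.eigenvalues i = 1 from h]; norm_num
    · simp only [h, if_false]; rw [(hev i).resolve_left h]; norm_num
  have hc1 : Fintype.card {i // p i} = m₁ := by
    rw [Fintype.card_subtype]
    rw [Finset.sum_congr rfl (fun i _ => hval i), Finset.sum_sub_distrib, ← Finset.mul_sum,
      Finset.sum_boole] at hsum
    simp at hsum
    have : ((Finset.univ.filter p).card : ℝ) = m₁ := by linarith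
    exact_mod_cast this
  have hc2 : Fintype.card {i // ¬ p i} = m₂ := by
    rw [Fintype.card_subtype_compl, hc1]; simp
  let e : Fin m₁ ⊕ Fin m₂ ≃ Fin m₁ ⊕ Fin m₂ :=
    (Equiv.sumCongr (Fintype.equivFinOfCardEq hc1).symm (Fintype.equivFinOfCardEq hc2).symm).trans
      (Equiv.sumCompl p)
  have he : (fun i => (hH.eigenvalues (e i) : ℂ)) = Sum.elim (fun _ => 1) (fun _ => -1) := by
    funext i
    rcases i with i | i
    · have : p (e (Sum.inl i)) := ((Fintype.equivFinOfCardEq hc1).symm i).2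
      have h2 : hH.eigenvalues (e (Sum.inl i)) = 1 := this
      simp [h2]
    · have : ¬ p (e (Sum.inr i)) := ((Fintype.equivFinOfCardEq hc2).symm i).2
      have h2 : hH.eigenvalues (e (Sum.inr i)) = -1 := (hev _).resolve_left this
      simp [h2]
  set W : BlockMat m₁ m₂ := (hH.eigenvectorUnitary : BlockMat m₁ m₂) with hW
  have hWm := hH.eigenvectorUnitary.2
  have hspec : C = W * Matrix.diagonal (fun i => (hH.eigenvalues i : ℂ)) * Wᴴ := by
    have := hH.spectral_theorem
    rw [Unitary.conjStarAlgAut_apply] at this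
    exact this
  have hWW : W * Wᴴ = 1 := (Matrix.mem_unitaryGroup_iff).1 hWm
  refine ⟨(W.submatrix id e)ᴴ, ?_, ?_⟩
  · rw [Matrix.mem_unitaryGroup_iff', Matrix.star_eq_conjTranspose,
      Matrix.conjTranspose_conjTranspose, Matrix.conjTranspose_submatrix,
      Matrix.submatrix_mul_equiv, hWW, Matrix.submatrix_id_id]
  · rw [sigJ_eq_diagonal, ← he, Matrix.conjTranspose_conjTranspose]
    have : Matrix.diagonal (fun i => (hH.eigenvalues (e i) : ℂ)) =
        (Matrix.diagonal (fun i => (hH.eigenvalues i : ℂ))).submatrix e e := by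
      rw [Matrix.submatrix_diagonal_equiv]; rfl
    rw [this, Matrix.submatrix_mul_equiv, Matrix.conjTranspose_submatrix,
      Matrix.submatrix_mul_equiv, ← hspec]; rfl

end Involution

/-! ### The spectrum of `A` and the regularized recursion -/

section Spectrum
variable {ι : Type*} [Fintype ι] [DecidableEq ι] {A : Matrix ι ι ℂ} {z : ℂ}

theorem notMem_spectrum_iff : z ∉ spectrum ℂ A ↔ IsUnit (A - z • 1) := by
  rw [spectrum.notMem_iff, ← IsUnit.neg_iff, neg_sub, Algebra.algebraMap_eq_smul_one]

theorem exists_left_eigenvector (h : z ∈ spectrum ℂ A) : ∃ f : ι → ℂ, f ≠ 0 ∧ f ᵥ* A = z • f := by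
  have h1 : (A - z • 1).det = 0 := by
    by_contra h2
    exact notMem_spectrum_iff.2 ((Matrix.isUnit_iff_isUnit_det _).2 (isUnit_iff_ne_zero.2 h2)) h
  obtain ⟨f, hf, hf2⟩ := Matrix.exists_vecMul_eq_zero_iff.2 h1
  refine ⟨f, hf, ?_⟩
  rw [Matrix.vecMul_sub, Matrix.vecMul_smul, Matrix.vecMul_one] at hf2
  exact sub_eq_zero.1 hf2

/-- The Popov–Belevitch–Hautus test: a left eigenvector of `A` that annihilates `B` vanishes if
the pair `{A, B}` is controllable. -/
theorem Controllable.eq_zero {n p : ℕ} {A : Matrix (Fin n) (Fin n) ℂ} {B : Matrix (Fin n) (Fin p) ℂ}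
    (h : Controllable A B) {f : Fin n → ℂ} (hf : f ᵥ* A = z • f) (hB : f ᵥ* B = 0) : f = 0 := by
  have hk : ∀ k : ℕ, f ᵥ* A ^ k = z ^ k • f := by
    intro k
    induction k with
    | zero => simp
    | succ k ih => rw [pow_succ, ← Matrix.vecMul_vecMul, ih, Matrix.smul_vecMul, hf,
        smul_smul, pow_succ]
  let φ : (Fin n → ℂ) →ₗ[ℂ] ℂ :=
    { toFun := fun y => f ⬝ᵥ y
      map_add' := fun x y => dotProduct_add _ _ _
      map_smul' := fun c x => dotProduct_smul _ _ _ }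
  have hφ : (⊤ : Submodule ℂ (Fin n → ℂ)) ≤ LinearMap.ker φ := by
    rw [← show _ = ⊤ from h]
    refine iSup_le fun k => ?_
    rintro _ ⟨x, rfl⟩
    change f ⬝ᵥ ((A ^ (k : ℕ) * B) *ᵥ x) = 0
    rw [Matrix.dotProduct_mulVec, ← Matrix.vecMul_vecMul, hk, Matrix.smul_vecMul, hB, smul_zero,
      zero_dotProduct]
  ext i
  have : f ⬝ᵥ Pi.single i 1 = 0 := hφ (Submodule.mem_top (x := Pi.single i 1))
  simpa using this

end Spectrum

namespace Triple
variable {m₁ m₂ n : ℕ} {T : Triple m₁ m₂ n}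

theorem StronglyAdmissible.eq_zero_of_toCols₁ (hT : T.StronglyAdmissible) {f : Fin n → ℂ} {z : ℂ}
    (hf : f ᵥ* T.A = z • f) (h : ∀ i, (f ᵥ* T.P₀) (Sum.inl i) = 0) : f = 0 :=
  hT.controllable.eq_zero hf (funext h)

/-- The spectrum of `A` lies in the open upper half-plane, by the Lyapunov identity and
controllability. -/
theorem StronglyAdmissible.im_pos (hT : T.StronglyAdmissible) {z : ℂ} (hz : z ∈ spectrum ℂ T.A) :
    0 < z.im := by
  obtain ⟨f, hf0, hf⟩ := exists_left_eigenvector hz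
  have hA : T.Aᴴ *ᵥ star f = star z • star f := by
    rw [← Matrix.star_vecMul, hf, star_smul]
  have h := congrArg (fun M => f ⬝ᵥ M *ᵥ star f) hT.identity
  have hP : f ⬝ᵥ (T.P₀ * T.P₀ᴴ) *ᵥ star f = (normSq (star (f ᵥ* T.P₀)) : ℂ) := by
    rw [← star_dotProduct_self, star_star, Matrix.star_vecMul, ← Matrix.mulVec_mulVec,
      Matrix.dotProduct_mulVec]
  have hpos : 0 < star (star f) ⬝ᵥ T.S₀ *ᵥ star f :=
    hT.posDef.dotProduct_mulVec_pos (star_ne_zero.2 hf0)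
  rw [star_star] at hpos
  simp only [Matrix.sub_mulVec, dotProduct_sub, Matrix.smul_mulVec, dotProduct_smul] at h
  rw [← Matrix.mulVec_mulVec, ← Matrix.mulVec_mulVec, hA, Matrix.dotProduct_mulVec f T.A, hf,
    smul_dotProduct, Matrix.mulVec_smul, dotProduct_smul, hP] at h
  obtain ⟨hre, him⟩ := Complex.pos_iff.1 hpos
  set s := f ⬝ᵥ T.S₀ *ᵥ star f
  have h2 : 2 * z.im * s.re = normSq (star (f ᵥ* T.P₀)) := by
    have := congrArg Complex.im h
    simp [← him] at this
    linarith
  rcases (normSq_nonneg (star (f ᵥ* T.P₀))).lt_or_eq with h3 | h3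
  · by_contra hneg
    nlinarith [mul_nonneg (neg_nonneg.2 (not_lt.1 hneg)) hre.le]
  · have h4 : f ᵥ* T.P₀ = 0 := star_eq_zero.1 (normSq_eq_zero.1 h3.symm)
    exact absurd (hT.eq_zero_of_toCols₁ hf fun i => by rw [h4]; rfl) hf0

theorem StronglyAdmissible.isUnit_sub (hT : T.StronglyAdmissible) {z : ℂ} (hz : z.im ≤ 0) :
    IsUnit (T.A - z • 1) :=
  notMem_spectrum_iff.1 fun h => (hT.im_pos h).not_ge hz

variable (T)

/-- The resolvent `(A - i)⁻¹`. -/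
noncomputable def D : Matrix (Fin n) (Fin n) ℂ := (T.A - Complex.I • 1)⁻¹

/-- The matrices `V_k = Q^{-k} Π_k`, where `Q = I - i A⁻¹`, defined by the recursion they satisfy.
The second block of columns of `V_k` does not depend on `k`. -/
noncomputable def V : ℕ → Matrix (Fin n) (Fin m₁ ⊕ Fin m₂) ℂ
  | 0 => T.P₀
  | k + 1 => V k + Complex.I • (T.D * V k * (1 + sigJ m₁ m₂))

/-- The matrices `R_k = Q^{-k} S_k Q^{-k*}`, where `Q = I - i A⁻¹`, defined by the recursion they
satisfy, which shows that they increase with `k`. -/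
noncomputable def R : ℕ → Matrix (Fin n) (Fin n) ℂ
  | 0 => T.S₀
  | k + 1 => R k + T.D * T.V k * (1 + sigJ m₁ m₂) * (T.V k)ᴴ * T.Dᴴ

variable {T}

theorem StronglyAdmissible.sub_mul_D (hT : T.StronglyAdmissible) :
    (T.A - Complex.I • 1) * T.D = 1 :=
  Matrix.mul_nonsing_inv _
    ((Matrix.isUnit_iff_isUnit_det _).1 (notMem_spectrum_iff.1 hT.not_mem_spectrum))

theorem StronglyAdmissible.D_mul_sub (hT : T.StronglyAdmissible) :
    T.D * (T.A - Complex.I • 1) = 1 :=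
  Matrix.nonsing_inv_mul _
    ((Matrix.isUnit_iff_isUnit_det _).1 (notMem_spectrum_iff.1 hT.not_mem_spectrum))

theorem StronglyAdmissible.A_mul_D (hT : T.StronglyAdmissible) :
    T.A * T.D = 1 + Complex.I • T.D := by
  rw [← hT.sub_mul_D, Matrix.sub_mul, Matrix.smul_mul, Matrix.one_mul]; abel

theorem StronglyAdmissible.lyapunov (hT : T.StronglyAdmissible) (k : ℕ) :
    T.A * T.R k - T.R k * T.Aᴴ = Complex.I • (T.V k * (T.V k)ᴴ) := by
  induction k with
  | zero => exact hT.identity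
  | succ k ih => exact lyapunov_step hT.A_mul_D sigJ_mul_self sigJ_conjTranspose ih

theorem one_add_sigJ_mul_self :
    (1 + sigJ m₁ m₂) * (1 + sigJ m₁ m₂) = (2 : ℂ) • (1 + sigJ m₁ m₂) := by
  rw [Matrix.mul_add, Matrix.add_mul, Matrix.add_mul, sigJ_mul_self]
  simp only [Matrix.one_mul, Matrix.mul_one]
  module

/-- The growth of the quadratic form of `R_k`. -/
theorem quadForm_R_succ (k : ℕ) (f : Fin n → ℂ) :
    star f ⬝ᵥ T.R (k + 1) *ᵥ f = star f ⬝ᵥ T.R k *ᵥ f +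
      ((normSq (((1 + sigJ m₁ m₂) * (T.V k)ᴴ * T.Dᴴ) *ᵥ f) / 2 : ℝ) : ℂ) := by
  have h : T.D * T.V k * (1 + sigJ m₁ m₂) * (T.V k)ᴴ * T.Dᴴ = (2⁻¹ : ℂ) •
      (((1 + sigJ m₁ m₂) * (T.V k)ᴴ * T.Dᴴ)ᴴ * ((1 + sigJ m₁ m₂) * (T.V k)ᴴ * T.Dᴴ)) := by
    simp only [Matrix.conjTranspose_mul, Matrix.conjTranspose_add, Matrix.conjTranspose_one,
      sigJ_conjTranspose, Matrix.conjTranspose_conjTranspose]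
    rw [Matrix.mul_assoc (1 + sigJ m₁ m₂), ← Matrix.mul_assoc _ (1 + sigJ m₁ m₂) (_ * _),
      ← Matrix.mul_assoc T.D,
      Matrix.mul_assoc (T.D * T.V k) (1 + sigJ m₁ m₂) (1 + sigJ m₁ m₂), one_add_sigJ_mul_self]
    simp only [Matrix.smul_mul, Matrix.mul_smul, smul_smul, Matrix.mul_assoc]
    norm_num
  rw [R, Matrix.add_mulVec, dotProduct_add, h, Matrix.smul_mulVec, dotProduct_smul,
    ← normSq_mulVec]
  push_cast
  rw [smul_eq_mul]; ring

theorem StronglyAdmissible.R_posDef (hT : T.StronglyAdmissible) (k : ℕ) : (T.R k).PosDef := by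
  induction k with
  | zero => exact hT.posDef
  | succ k ih =>
    refine Matrix.PosDef.of_dotProduct_mulVec_pos ?_ fun f hf => ?_
    · have h1 : (T.R k)ᴴ = T.R k := ih.isHermitian
      change (T.R (k + 1))ᴴ = _
      simp [R, h1, sigJ_conjTranspose, Matrix.mul_assoc]
    · rw [quadForm_R_succ]
      refine add_pos_of_pos_of_nonneg (ih.dotProduct_mulVec_pos hf) ?_
      exact_mod_cast div_nonneg (normSq_nonneg _) zero_le_two

theorem StronglyAdmissible.isUnit_A (hT : T.StronglyAdmissible) : IsUnit T.A := by
  simpa using hT.isUnit_sub (z := 0) (by simp)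

variable (T) in
/-- The matrix `Q = I - i A⁻¹`. -/
noncomputable def Q : Matrix (Fin n) (Fin n) ℂ := 1 - Complex.I • T.A⁻¹

theorem StronglyAdmissible.Q_mul_D (hT : T.StronglyAdmissible) : T.Q * T.D = T.A⁻¹ := by
  have hu : IsUnit T.A.det := (Matrix.isUnit_iff_isUnit_det _).1 hT.isUnit_A
  have h : T.Q = T.A⁻¹ * (T.A - Complex.I • 1) := by
    rw [Q, Matrix.mul_sub, Matrix.nonsing_inv_mul _ hu, Matrix.mul_smul, Matrix.mul_one]
  rw [h, Matrix.mul_assoc, hT.sub_mul_D, Matrix.mul_one]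

theorem StronglyAdmissible.isUnit_Q (hT : T.StronglyAdmissible) : IsUnit T.Q :=
  IsUnit.of_mul_eq_one (T.D * T.A) (by
    rw [← Matrix.mul_assoc, hT.Q_mul_D,
      Matrix.nonsing_inv_mul _ ((Matrix.isUnit_iff_isUnit_det _).1 hT.isUnit_A)])

theorem StronglyAdmissible.commute_Q (hT : T.StronglyAdmissible) (k : ℕ) :
    Commute (T.Q ^ k) T.A := by
  have hu : IsUnit T.A.det := (Matrix.isUnit_iff_isUnit_det _).1 hT.isUnit_A
  refine Commute.pow_left ?_ k
  rw [Commute, SemiconjBy, Q]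
  rw [Matrix.sub_mul, Matrix.mul_sub, Matrix.smul_mul, Matrix.mul_smul, Matrix.nonsing_inv_mul _ hu,
    Matrix.mul_nonsing_inv _ hu, Matrix.one_mul, Matrix.mul_one]

theorem StronglyAdmissible.inv_A_mul_pow (hT : T.StronglyAdmissible) (k : ℕ) :
    T.A⁻¹ * T.Q ^ k = T.Q ^ (k + 1) * T.D := by
  have h : Commute (T.Q ^ k) T.A⁻¹ := by
    refine Commute.pow_left ?_ k
    rw [Commute, SemiconjBy, Q, Matrix.sub_mul, Matrix.mul_sub, Matrix.smul_mul, Matrix.mul_smul,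
      Matrix.one_mul, Matrix.mul_one]
  rw [← h.eq, ← hT.Q_mul_D, pow_succ, Matrix.mul_assoc]

theorem StronglyAdmissible.P_eq (hT : T.StronglyAdmissible) (k : ℕ) : T.P k = T.Q ^ k * T.V k := by
  induction k with
  | zero => simp [P, V]
  | succ k ih =>
    have h : T.A⁻¹ * T.Q ^ k * T.V k = T.Q ^ (k + 1) * (T.D * T.V k) := by
      rw [hT.inv_A_mul_pow, Matrix.mul_assoc]
    have h2 : T.Q ^ k * T.V k = T.Q ^ (k + 1) * T.V k + Complex.I • (T.A⁻¹ * T.Q ^ k * T.V k) := by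
      rw [pow_succ', ← Matrix.smul_mul, ← Matrix.smul_mul, ← Matrix.add_mul, ← Matrix.add_mul, Q]
      simp
    rw [P, V, ih, ← Matrix.mul_assoc, h, Matrix.mul_add, h2, h]
    simp only [Matrix.mul_add, Matrix.mul_smul, Matrix.mul_one, Matrix.mul_assoc]
    module

theorem StronglyAdmissible.S_eq (hT : T.StronglyAdmissible) (k : ℕ) :
    T.S k = T.Q ^ k * T.R k * (T.Q ^ k)ᴴ := by
  induction k with
  | zero => simp [S, R]
  | succ k ih =>
    have hu : IsUnit T.A.det := (Matrix.isUnit_iff_isUnit_det _).1 hT.isUnit_A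
    have hL : T.A * T.S k - T.S k * T.Aᴴ = Complex.I • (T.P k * (T.P k)ᴴ) := by
      have h := congrArg (fun M => T.Q ^ k * M * (T.Q ^ k)ᴴ) (hT.lyapunov k)
      have hc := (hT.commute_Q k).eq
      have hcH : T.Aᴴ * (T.Q ^ k)ᴴ = (T.Q ^ k)ᴴ * T.Aᴴ := by
        rw [← Matrix.conjTranspose_mul, hc, Matrix.conjTranspose_mul]
      simp only [Matrix.mul_sub, Matrix.sub_mul, Matrix.mul_smul, Matrix.smul_mul] at h
      rw [ih, hT.P_eq, Matrix.conjTranspose_mul]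
      rw [← Matrix.mul_assoc, hc] at h
      simp only [Matrix.mul_assoc] at h ⊢
      rw [← hcH, h]
    have hL2 := congrArg (fun M => T.A⁻¹ * M * (T.A⁻¹)ᴴ) hL
    have hAH : T.Aᴴ * (T.A⁻¹)ᴴ = 1 := by
      rw [← Matrix.conjTranspose_mul, Matrix.nonsing_inv_mul _ hu, Matrix.conjTranspose_one]
    simp only [Matrix.mul_sub, Matrix.sub_mul, Matrix.mul_smul, Matrix.smul_mul] at hL2
    rw [← Matrix.mul_assoc, Matrix.nonsing_inv_mul _ hu, Matrix.one_mul, ← Matrix.mul_assoc,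
      Matrix.mul_assoc _ T.Aᴴ, hAH, Matrix.mul_one] at hL2
    have h1 : T.Q ^ (k + 1) * (T.D * T.V k) = T.A⁻¹ * T.P k := by
      rw [← Matrix.mul_assoc, ← hT.inv_A_mul_pow, Matrix.mul_assoc, hT.P_eq]
    have h3 : T.Q ^ (k + 1) * T.R (k + 1) * (T.Q ^ (k + 1))ᴴ = T.Q * T.S k * T.Qᴴ +
        (T.A⁻¹ * T.P k) * (1 + sigJ m₁ m₂) * (T.A⁻¹ * T.P k)ᴴ := by
      rw [← h1, R, ih, pow_succ']
      simp only [Matrix.mul_add, Matrix.add_mul, Matrix.conjTranspose_mul, Matrix.mul_assoc,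
        Matrix.mul_one]
    rw [h3, S, Q]
    simp only [Matrix.conjTranspose_sub, Matrix.conjTranspose_one, Matrix.conjTranspose_smul,
      Complex.star_def, Complex.conj_I, Matrix.conjTranspose_mul, Matrix.mul_add, Matrix.add_mul,
      Matrix.mul_sub, Matrix.sub_mul, Matrix.mul_smul, Matrix.smul_mul, Matrix.mul_one,
      Matrix.one_mul, ← Matrix.conjTranspose_nonsing_inv, Matrix.mul_assoc] at hL2 ⊢
    linear_combination (norm := (match_scalars <;> ring_nf <;> simp [Complex.I_sq]))
      -Complex.I • hL2

theorem StronglyAdmissible.S_posDef (hT : T.StronglyAdmissible) (k : ℕ) : (T.S k).PosDef := by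
  rw [hT.S_eq]
  exact (hT.R_posDef k).mul_mul_conjTranspose_same
    (Matrix.vecMul_injective_of_isUnit (hT.isUnit_Q.pow k))

theorem StronglyAdmissible.conjTranspose_P_mul (hT : T.StronglyAdmissible) (k : ℕ) :
    (T.P k)ᴴ * (T.S k)⁻¹ * T.Q ^ k = (T.V k)ᴴ * (T.R k)⁻¹ := by
  have hQ : IsUnit (T.Q ^ k).det := (Matrix.isUnit_iff_isUnit_det _).1 (hT.isUnit_Q.pow k)
  have hQH : IsUnit ((T.Q ^ k)ᴴ).det := by rw [Matrix.det_conjTranspose]; exact hQ.star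
  rw [hT.P_eq, hT.S_eq, Matrix.mul_inv_rev, Matrix.mul_inv_rev, Matrix.conjTranspose_mul]
  simp only [Matrix.mul_assoc]
  rw [Matrix.nonsing_inv_mul _ hQ, Matrix.mul_one, ← Matrix.mul_assoc (T.Q ^ k)ᴴ,
    Matrix.mul_nonsing_inv _ hQH, Matrix.one_mul]

theorem StronglyAdmissible.gram_eq (hT : T.StronglyAdmissible) (k : ℕ) :
    (T.P k)ᴴ * (T.S k)⁻¹ * T.P k = (T.V k)ᴴ * (T.R k)⁻¹ * T.V k := by
  conv_lhs => rw [hT.P_eq k, ← hT.P_eq k]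
  nth_rewrite 2 [hT.P_eq k]
  rw [← Matrix.mul_assoc, hT.conjTranspose_P_mul]

theorem StronglyAdmissible.transfer_eq (hT : T.StronglyAdmissible) (k : ℕ) {lam : ℂ}
    (hl : IsUnit (T.A - lam • 1)) :
    T.transfer k lam = realization T.A (T.R k) (T.V k) lam := by
  have hu : IsUnit (T.A - lam • 1).det := (Matrix.isUnit_iff_isUnit_det _).1 hl
  have hc : (T.A - lam • 1)⁻¹ * T.Q ^ k = T.Q ^ k * (T.A - lam • 1)⁻¹ := by
    have h : (T.A - lam • 1) * T.Q ^ k = T.Q ^ k * (T.A - lam • 1) := by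
      rw [Matrix.sub_mul, Matrix.mul_sub, (hT.commute_Q k).eq, Matrix.smul_mul, Matrix.mul_smul,
        Matrix.one_mul, Matrix.mul_one]
    have h2 := congrArg (fun M => (T.A - lam • 1)⁻¹ * M * (T.A - lam • 1)⁻¹) h
    simp only [← Matrix.mul_assoc] at h2
    rw [Matrix.nonsing_inv_mul _ hu, Matrix.one_mul, Matrix.mul_assoc _ (T.A - lam • 1),
      Matrix.mul_nonsing_inv _ hu, Matrix.mul_one] at h2
    exact h2.symm
  have h : (T.P k)ᴴ * (T.S k)⁻¹ * (T.A - lam • 1)⁻¹ * T.P k =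
      (T.V k)ᴴ * (T.R k)⁻¹ * (T.A - lam • 1)⁻¹ * T.V k := by
    nth_rewrite 2 [hT.P_eq k]
    rw [← hT.conjTranspose_P_mul, Matrix.mul_assoc _ (T.Q ^ k), ← hc]
    simp only [Matrix.mul_assoc]
  rw [transfer, h, realization]

theorem StronglyAdmissible.potential_eq (hT : T.StronglyAdmissible) (k : ℕ) :
    T.potential k = sigJ m₁ m₂ + (T.V k)ᴴ * (T.R k)⁻¹ * T.V k -
      (T.V (k + 1))ᴴ * (T.R (k + 1))⁻¹ * T.V (k + 1) := by
  rw [potential, hT.gram_eq, hT.gram_eq]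

end Triple

/-! ### Growth of `R_k` and the limit of the transfer functions -/

namespace Triple
variable {m₁ m₂ n : ℕ} {T : Triple m₁ m₂ n}

variable (m₁ m₂) in
/-- The last `m₂` columns of the identity matrix of order `m₁ + m₂`. -/
abbrev lastCols : Matrix (Fin m₁ ⊕ Fin m₂) (Fin m₂) ℂ := Matrix.fromRows 0 1

theorem one_add_sigJ_mul_lastCols : (1 + sigJ m₁ m₂) * lastCols m₁ m₂ = 0 := by
  rw [sigJ, ← Matrix.fromBlocks_one, Matrix.fromBlocks_add, Matrix.fromBlocks_mul_fromRows]
  simp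

theorem V_mul_lastCols (k : ℕ) :
    T.V k * lastCols m₁ m₂ = T.P₀ * lastCols m₁ m₂ := by
  induction k with
  | zero => rfl
  | succ k ih =>
    rw [V, Matrix.add_mul, ih, Matrix.smul_mul, Matrix.mul_assoc _ (1 + _),
      one_add_sigJ_mul_lastCols, Matrix.mul_zero, smul_zero, add_zero]

/-- The first block of `V_k^*` evolves by the powers of `1 - 2 i D^*`. -/
theorem one_add_sigJ_mul_conjTranspose_V (k : ℕ) :
    (1 + sigJ m₁ m₂) * (T.V k)ᴴ =
      (1 + sigJ m₁ m₂) * T.P₀ᴴ * (1 - (2 * Complex.I) • T.Dᴴ) ^ k := by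
  induction k with
  | zero => simp [V]
  | succ k ih =>
    rw [pow_succ, ← Matrix.mul_assoc, ← ih, V, Matrix.conjTranspose_add,
      Matrix.conjTranspose_smul, Matrix.conjTranspose_mul, Matrix.conjTranspose_mul,
      Matrix.conjTranspose_add, Matrix.conjTranspose_one, sigJ_conjTranspose, Matrix.mul_add,
      Matrix.mul_smul, ← Matrix.mul_assoc, one_add_sigJ_mul_self, Matrix.mul_sub, Matrix.mul_smul]
    simp only [Matrix.smul_mul, Matrix.mul_assoc, Matrix.mul_one, Complex.star_def, Complex.conj_I]
    module

variable (T) in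
/-- The quadratic form of `R_k`. -/
noncomputable def quadR (k : ℕ) (f : Fin n → ℂ) : ℝ := (star f ⬝ᵥ T.R k *ᵥ f).re

theorem quadR_succ (k : ℕ) (f : Fin n → ℂ) :
    T.quadR (k + 1) f = T.quadR k f + normSq (((1 + sigJ m₁ m₂) * T.P₀ᴴ) *ᵥ
      ((1 - (2 * Complex.I) • T.Dᴴ) ^ k *ᵥ (T.Dᴴ *ᵥ f))) / 2 := by
  rw [quadR, quadForm_R_succ, one_add_sigJ_mul_conjTranspose_V, Matrix.mulVec_mulVec,
    Matrix.mulVec_mulVec]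
  simp only [Complex.add_re, Complex.ofReal_re]
  rfl

theorem quadR_mono (f : Fin n → ℂ) : Monotone fun k => T.quadR k f :=
  monotone_nat_of_le_succ fun k => by
    rw [quadR_succ]; linarith [normSq_nonneg (((1 + sigJ m₁ m₂) * T.P₀ᴴ) *ᵥ
      ((1 - (2 * Complex.I) • T.Dᴴ) ^ k *ᵥ (T.Dᴴ *ᵥ f)))]

theorem quadR_smul (c : ℂ) (k : ℕ) (f : Fin n → ℂ) :
    T.quadR k (c • f) = ‖c‖ ^ 2 * T.quadR k f := by
  rw [quadR, quadR, star_smul, Matrix.mulVec_smul, smul_dotProduct, dotProduct_smul, smul_smul,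
    smul_eq_mul, Complex.star_def, Complex.conj_mul']
  rw [← Complex.ofReal_pow, Complex.re_ofReal_mul]

theorem continuous_quadR (k : ℕ) : Continuous (T.quadR k) := by
  unfold quadR
  fun_prop

/-- No nonzero vector is annihilated asymptotically by the growth terms of `R_k`. The vectors
annihilated asymptotically form a subspace invariant under `D^*`; an eigenvector of `D^*` in it
would be, up to conjugation, a left eigenvector of `A` contradicting controllability, because the
eigenvalues of `1 - 2 i D^*` have modulus at least one. -/
theorem StronglyAdmissible.eq_zero_of_tendsto (hT : T.StronglyAdmissible) {h : Fin n → ℂ}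
    (hh : Tendsto (fun k : ℕ => ((1 + sigJ m₁ m₂) * T.P₀ᴴ) *ᵥ
      ((1 - (2 * Complex.I) • T.Dᴴ) ^ k *ᵥ h)) atTop (𝓝 0)) : h = 0 := by
  by_contra hne
  set G := 1 - (2 * Complex.I) • T.Dᴴ with hG
  set E := (1 + sigJ m₁ m₂) * T.P₀ᴴ with hE
  let N : Submodule ℂ (Fin n → ℂ) :=
    { carrier := {h | Tendsto (fun k : ℕ => E *ᵥ (G ^ k *ᵥ h)) atTop (𝓝 0)}
      zero_mem' := by simp
      add_mem' := fun {a b} ha hb => by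
        have := ha.add hb
        simpa only [Set.mem_ofPred_eq, Matrix.mulVec_add, add_zero] using this
      smul_mem' := fun c a ha => by
        have := ha.const_smul c
        simpa only [Set.mem_ofPred_eq, Matrix.mulVec_smul, smul_zero] using this }
  have hinv : ∀ x ∈ N, T.Dᴴ.mulVecLin x ∈ N := by
    intro x hx
    change Tendsto (fun k : ℕ => E *ᵥ (G ^ k *ᵥ (T.Dᴴ *ᵥ x))) atTop (𝓝 0)
    have hx' : Tendsto (fun k : ℕ => E *ᵥ (G ^ k *ᵥ x)) atTop (𝓝 0) := hx
    have h1 := (hx'.sub (hx'.comp (tendsto_add_atTop_nat 1))).const_smul (2 * Complex.I)⁻¹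
    simp only [sub_zero, smul_zero] at h1
    refine h1.congr fun k => ?_
    have : T.Dᴴ *ᵥ x = (2 * Complex.I)⁻¹ • (x - G *ᵥ x) := by
      rw [hG, Matrix.sub_mulVec, Matrix.one_mulVec, sub_sub_cancel, Matrix.smul_mulVec, smul_smul,
        inv_mul_cancel₀ (by simp), one_smul]
    rw [this, Function.comp_apply, pow_succ, Matrix.mulVec_smul, Matrix.mulVec_smul,
      Matrix.mulVec_sub, Matrix.mulVec_sub, Matrix.mulVec_mulVec x (G ^ k) G]
  have hN : Nontrivial N := ⟨⟨⟨h, hh⟩, 0, fun heq => hne (congrArg Subtype.val heq)⟩⟩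
  obtain ⟨β, hβ⟩ := Module.End.exists_eigenvalue (T.Dᴴ.mulVecLin.restrict hinv)
  obtain ⟨⟨x, hxN⟩, hx⟩ := hβ.exists_hasEigenvector
  have hx0 : x ≠ 0 := fun h => hx.2 (Subtype.ext h)
  have hDx : T.Dᴴ *ᵥ x = β • x := congrArg Subtype.val hx.apply_eq_smul
  have hDA : (T.Aᴴ + Complex.I • 1) * T.Dᴴ = 1 := by
    have := congrArg Matrix.conjTranspose hT.D_mul_sub
    simpa [Matrix.conjTranspose_mul, sub_eq_add_neg] using this
  have h1 : x = β • (T.Aᴴ *ᵥ x + Complex.I • x) := by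
    have := congrArg (· *ᵥ x) hDA
    simp only [← Matrix.mulVec_mulVec, hDx, Matrix.mulVec_smul, Matrix.add_mulVec,
      Matrix.smul_mulVec, Matrix.one_mulVec] at this
    exact this.symm
  have hβ0 : β ≠ 0 := by
    rintro rfl
    rw [zero_smul] at h1
    exact hx0 h1
  have hAx : T.Aᴴ *ᵥ x = (β⁻¹ - Complex.I) • x := by
    have := congrArg (β⁻¹ • ·) h1
    simp only [smul_smul, inv_mul_cancel₀ hβ0, one_smul] at this
    rw [sub_smul, this]; abel
  have hfA : star x ᵥ* T.A = star (β⁻¹ - Complex.I) • star x := by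
    rw [← star_smul, ← hAx, Matrix.star_mulVec, Matrix.conjTranspose_conjTranspose]
  have hsp : star (β⁻¹ - Complex.I) ∈ spectrum ℂ T.A := by
    by_contra hns
    have hu := notMem_spectrum_iff.1 hns
    have : star x ᵥ* (T.A - star (β⁻¹ - Complex.I) • 1) = 0 := by
      rw [Matrix.vecMul_sub, hfA, Matrix.vecMul_smul, Matrix.vecMul_one, sub_self]
    have h2 := Matrix.vecMul_injective_of_isUnit hu (this.trans (Matrix.zero_vecMul _).symm)
    exact hx0 (star_eq_zero.1 h2)
  have him := hT.im_pos hsp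
  have hmod : 1 ≤ ‖1 - 2 * Complex.I * β‖ := by
    have h2 : 1 - 2 * Complex.I * β = (β⁻¹ - 2 * Complex.I) * β := by
      rw [sub_mul, inv_mul_cancel₀ hβ0]
    have h3 : ‖β⁻¹‖ ≤ ‖β⁻¹ - 2 * Complex.I‖ := by
      rw [← sq_le_sq₀ (norm_nonneg _) (norm_nonneg _), Complex.sq_norm, Complex.sq_norm,
        Complex.normSq_apply, Complex.normSq_apply]
      generalize β⁻¹ = γ at him ⊢
      simp only [Complex.star_def, Complex.conj_im, Complex.sub_im, Complex.I_im] at him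
      simp
      nlinarith
    rw [h2, norm_mul]
    calc (1 : ℝ) = ‖β⁻¹‖ * ‖β‖ := by rw [← norm_mul, inv_mul_cancel₀ hβ0, norm_one]
      _ ≤ _ := by gcongr
  have hGx : ∀ k : ℕ, G ^ k *ᵥ x = (1 - 2 * Complex.I * β) ^ k • x := by
    intro k
    induction k with
    | zero => simp
    | succ k ih =>
      rw [pow_succ', ← Matrix.mulVec_mulVec, ih, Matrix.mulVec_smul, hG, Matrix.sub_mulVec,
        Matrix.one_mulVec, Matrix.smul_mulVec, hDx, pow_succ]
      module
  have hEx : E *ᵥ x = 0 := by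
    ext i
    have h3 : Tendsto (fun k : ℕ => E *ᵥ (G ^ k *ᵥ x)) atTop (𝓝 0) := hxN
    have h4 := (tendsto_pi_nhds.1 h3 i).norm
    simp only [hGx, Matrix.mulVec_smul, Pi.smul_apply, smul_eq_mul, norm_mul, norm_pow,
      Pi.zero_apply, norm_zero] at h4
    refine norm_le_zero_iff.1 (ge_of_tendsto' h4 fun k => ?_)
    exact le_mul_of_one_le_left (norm_nonneg _) (one_le_pow₀ hmod)
  refine hx0 (star_eq_zero.1 (hT.eq_zero_of_toCols₁ hfA fun i => ?_))
  have h5 := congrFun hEx (Sum.inl i)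
  rw [hE, ← Matrix.mulVec_mulVec, Matrix.add_mulVec, Matrix.one_mulVec, sigJ_eq_diagonal] at h5
  simp only [Pi.add_apply, Matrix.mulVec_diagonal, Sum.elim_inl, one_mul, Pi.zero_apply] at h5
  have h6 : (T.P₀ᴴ *ᵥ x) (Sum.inl i) = 0 := by linear_combination h5 / 2
  have h7 : star x ᵥ* T.P₀ = star (T.P₀ᴴ *ᵥ x) := by
    rw [Matrix.star_mulVec, Matrix.conjTranspose_conjTranspose]
  rw [h7, Pi.star_apply, h6, star_zero]

theorem StronglyAdmissible.D_conjTranspose_mulVec_ne_zero (hT : T.StronglyAdmissible)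
    {f : Fin n → ℂ} (hf : f ≠ 0) : T.Dᴴ *ᵥ f ≠ 0 := by
  intro h
  have hAD : (T.Aᴴ + Complex.I • 1) * T.Dᴴ = 1 := by
    have := congrArg Matrix.conjTranspose hT.D_mul_sub
    simpa [Matrix.conjTranspose_mul, sub_eq_add_neg] using this
  apply hf
  rw [← Matrix.one_mulVec f, ← hAD, ← Matrix.mulVec_mulVec, h, Matrix.mulVec_zero]

theorem StronglyAdmissible.quadR_unbounded (hT : T.StronglyAdmissible) {f : Fin n → ℂ}
    (hf : f ≠ 0) (c : ℝ) : ∃ k, c < T.quadR k f := by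
  by_contra! hc
  refine hT.D_conjTranspose_mulVec_ne_zero hf (hT.eq_zero_of_tendsto (tendsto_zero_of_normSq ?_))
  have h1 := tendsto_atTop_ciSup (quadR_mono (T := T) f) ⟨c, by rintro _ ⟨k, rfl⟩; exact hc k⟩
  have h2 := ((h1.comp (tendsto_add_atTop_nat 1)).sub h1).const_mul 2
  rw [sub_self, mul_zero] at h2
  refine h2.congr fun k => ?_
  simp only [Function.comp_apply]
  rw [quadR_succ]; ring

/-- `R_k` tends to infinity, uniformly on the unit sphere. -/
theorem StronglyAdmissible.exists_le_quadR (hT : T.StronglyAdmissible) (c : ℝ) :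
    ∃ K, ∀ k ≥ K, ∀ f, c * normSq f ≤ T.quadR k f := by
  suffices h : ∃ K, ∀ f, normSq f = 1 → c < T.quadR K f by
    obtain ⟨K, hK⟩ := h
    refine ⟨K, fun k hk f => le_trans ?_ (quadR_mono f hk)⟩
    by_cases hf : f = 0
    · simp [hf, quadR]
    have hpos : 0 < normSq f := (normSq_nonneg f).lt_of_ne' fun h => hf (normSq_eq_zero.1 h)
    have hs : ‖((Real.sqrt (normSq f))⁻¹ : ℂ)‖ ^ 2 = (normSq f)⁻¹ := by
      rw [norm_inv, Complex.norm_real, inv_pow, Real.norm_eq_abs, sq_abs, Real.sq_sqrt hpos.le]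
    have := hK (((Real.sqrt (normSq f))⁻¹ : ℂ) • f) (by
      rw [normSq_smul, hs, inv_mul_cancel₀ hpos.ne'])
    rw [quadR_smul, hs, lt_inv_mul_iff₀ hpos] at this
    linarith
  by_contra! hcon
  let t : ℕ → Set (Fin n → ℂ) := fun k => {f | normSq f = 1 ∧ T.quadR k f ≤ c}
  have hcl : ∀ k, IsClosed (t k) := fun k =>
    (isClosed_eq continuous_normSq continuous_const).inter
      (isClosed_le (continuous_quadR k) continuous_const)
  have hcomp : IsCompact (t 0) := by
    refine Metric.isCompact_of_isClosed_isBounded (hcl 0)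
      ((Metric.isBounded_closedBall (x := (0 : Fin n → ℂ)) (r := 1)).subset fun f hf => ?_)
    rw [mem_closedBall_zero_iff, pi_norm_le_iff_of_nonneg zero_le_one]
    intro i
    have := sq_norm_apply_le_normSq f i
    rw [hf.1] at this
    exact (sq_le_one_iff₀ (norm_nonneg _)).1 this
  obtain ⟨f, hf⟩ := IsCompact.nonempty_iInter_of_sequence_nonempty_isCompact_isClosed t
    (fun k f hf => ⟨hf.1, (quadR_mono f k.le_succ).trans hf.2⟩)
    (fun k => (hcon k).imp fun f hf => hf) hcomp hcl
  rw [Set.mem_iInter] at hf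
  have hf0 : f ≠ 0 := by
    rintro rfl
    simpa using (hf 0).1
  obtain ⟨k, hk⟩ := hT.quadR_unbounded hf0 c
  exact hk.not_ge (hf k).2

/-- The vectors `V_k^* R_k⁻¹ v` tend to zero: with `u = R_k⁻¹ v`, the Lyapunov identity gives
`|V_k^* u|² = 2 Im (u^* A v)`, and `u` is small since `R_k` is large. -/
theorem StronglyAdmissible.tendsto_V_mulVec (hT : T.StronglyAdmissible) (v : Fin n → ℂ) :
    Tendsto (fun k => ((T.V k)ᴴ * (T.R k)⁻¹) *ᵥ v) atTop (𝓝 0) := by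
  refine tendsto_zero_of_normSq ?_
  set a := normSq v + normSq (T.A *ᵥ v)
  have ha : 0 ≤ a := add_nonneg (normSq_nonneg _) (normSq_nonneg _)
  have key : ∀ c : ℝ, 0 < c → ∀ k, (∀ f, c * normSq f ≤ T.quadR k f) →
      normSq (((T.V k)ᴴ * (T.R k)⁻¹) *ᵥ v) ≤ c⁻¹ * a := by
    intro c hc k hk
    set u := (T.R k)⁻¹ *ᵥ v with hu
    have hRu : IsUnit (T.R k).det := (Matrix.isUnit_iff_isUnit_det _).1 (hT.R_posDef k).isUnit
    have hRuv : T.R k *ᵥ u = v := by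
      rw [hu, Matrix.mulVec_mulVec, Matrix.mul_nonsing_inv _ hRu, Matrix.one_mulVec]
    have huR : star u ᵥ* T.R k = star v := by
      conv_rhs => rw [← hRuv, Matrix.star_mulVec, (hT.R_posDef k).isHermitian.eq]
    have h1 : c * normSq u ≤ ‖star u ⬝ᵥ v‖ := by
      refine (hk u).trans ?_
      rw [quadR, hRuv]
      exact Complex.re_le_norm _
    have h2 := two_mul_norm_dotProduct_le u v hc
    have h3 : c * normSq u ≤ c⁻¹ * normSq v := by linarith
    have h4 : (normSq ((T.V k)ᴴ *ᵥ u) : ℂ) =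
        -Complex.I * (star u ⬝ᵥ T.A *ᵥ v - star (star u ⬝ᵥ T.A *ᵥ v)) := by
      have h5 := congrArg (fun M => star u ⬝ᵥ M *ᵥ u) (hT.lyapunov k)
      simp only [Matrix.sub_mulVec, dotProduct_sub, Matrix.smul_mulVec, dotProduct_smul] at h5
      have h6 := normSq_mulVec (T.V k)ᴴ u
      rw [Matrix.conjTranspose_conjTranspose] at h6
      rw [← h6, ← Matrix.mulVec_mulVec, ← Matrix.mulVec_mulVec, hRuv,
        Matrix.dotProduct_mulVec _ (T.R k), huR] at h5
      have h7 : star (star u ⬝ᵥ T.A *ᵥ v) = star v ⬝ᵥ T.Aᴴ *ᵥ u := by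
        rw [← Matrix.star_dotProduct, Matrix.star_mulVec, ← Matrix.dotProduct_mulVec]
      rw [h7, h5, smul_eq_mul, ← mul_assoc]
      simp
    have h5 : normSq ((T.V k)ᴴ *ᵥ u) ≤ 2 * ‖star u ⬝ᵥ T.A *ᵥ v‖ := by
      have h6 : normSq ((T.V k)ᴴ *ᵥ u) = ‖(normSq ((T.V k)ᴴ *ᵥ u) : ℂ)‖ := by
        rw [Complex.norm_real, Real.norm_of_nonneg (normSq_nonneg _)]
      rw [h6, h4, norm_mul, norm_neg, Complex.norm_I, one_mul, two_mul]
      exact (norm_sub_le _ _).trans (by rw [norm_star])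
    have h6 := two_mul_norm_dotProduct_le u (T.A *ᵥ v) hc
    rw [← Matrix.mulVec_mulVec, ← hu]
    have : c⁻¹ * a = c⁻¹ * normSq v + c⁻¹ * normSq (T.A *ᵥ v) := mul_add _ _ _
    linarith
  rw [Metric.tendsto_atTop]
  intro ε hε
  obtain ⟨K, hK⟩ := hT.exists_le_quadR ((a + 1) / ε)
  refine ⟨K, fun k hk => ?_⟩
  have := key _ (by positivity) k (hK k hk)
  rw [Real.dist_eq, sub_zero, abs_of_nonneg (normSq_nonneg _)]
  refine this.trans_lt ?_
  rw [inv_div, div_mul_eq_mul_div, div_lt_iff₀ (by positivity)]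
  nlinarith

theorem StronglyAdmissible.tendsto_V_mul (hT : T.StronglyAdmissible) {p : ℕ}
    (M : Matrix (Fin n) (Fin p) ℂ) :
    Tendsto (fun k => (T.V k)ᴴ * (T.R k)⁻¹ * M) atTop (𝓝 0) := by
  refine tendsto_pi_nhds.2 fun i => tendsto_pi_nhds.2 fun l => ?_
  exact tendsto_pi_nhds.1 (hT.tendsto_V_mulVec (fun x => M x l)) i

theorem StronglyAdmissible.tendsto_transfer (hT : T.StronglyAdmissible) {lam : ℂ}
    (hl : IsUnit (T.A - lam • 1)) :
    Tendsto (fun k => T.transfer k lam * lastCols m₁ m₂) atTop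
      (𝓝 (lastCols m₁ m₂)) := by
  have h := (hT.tendsto_V_mul ((T.A - lam • 1)⁻¹ * (T.P₀ *
    lastCols m₁ m₂))).const_smul Complex.I
  have h2 := (tendsto_const_nhds (x := lastCols m₁ m₂)).sub h
  rw [smul_zero, sub_zero] at h2
  refine h2.congr fun k => ?_
  rw [hT.transfer_eq k hl, realization, Matrix.sub_mul, Matrix.one_mul, Matrix.smul_mul,
    ← V_mul_lastCols k]
  simp only [Matrix.mul_assoc]

end Triple

/-! ### The potential -/

namespace Triple
variable {m₁ m₂ n : ℕ} {T : Triple m₁ m₂ n}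

theorem StronglyAdmissible.transfer_succ_mul (hT : T.StronglyAdmissible) (k : ℕ) {lam : ℂ}
    (hl : IsUnit (T.A - lam • 1)) :
    T.transfer (k + 1) lam * (lam • 1 - Complex.I • sigJ m₁ m₂) =
      (lam • 1 - Complex.I • T.potential k) * T.transfer k lam := by
  rw [hT.transfer_eq _ hl, hT.transfer_eq _ hl, hT.potential_eq]
  exact darboux hT.sub_mul_D (hT.R_posDef k).isUnit (hT.R_posDef (k + 1)).isUnit sigJ_mul_self
    sigJ_conjTranspose (hT.lyapunov k) rfl rfl hl

theorem StronglyAdmissible.transfer_mul_conjTranspose (hT : T.StronglyAdmissible) (k : ℕ)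
    {lam μ : ℂ} (hμ : μ = star lam) (hl : IsUnit (T.A - lam • 1)) (hm : IsUnit (T.A - μ • 1)) :
    T.transfer k lam * (T.transfer k μ)ᴴ = 1 := by
  rw [hT.transfer_eq _ hl, hT.transfer_eq _ hm]
  exact realization_mul_conjTranspose (hT.R_posDef k) (hT.lyapunov k) hμ hl hm

theorem StronglyAdmissible.potential_conjTranspose (hT : T.StronglyAdmissible) (k : ℕ) :
    (T.potential k)ᴴ = T.potential k := by
  have h : ∀ k, ((T.S k)⁻¹)ᴴ = (T.S k)⁻¹ := fun k => (hT.S_posDef k).inv.isHermitian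
  simp only [potential, Matrix.conjTranspose_sub, Matrix.conjTranspose_add,
    Matrix.conjTranspose_mul, h, sigJ_conjTranspose, Matrix.conjTranspose_conjTranspose,
    Matrix.mul_assoc]

theorem StronglyAdmissible.potential_mul_self (hT : T.StronglyAdmissible) (k : ℕ) :
    T.potential k * T.potential k = 1 := by
  have hu : IsUnit (T.A - (1 : ℂ) • 1) := hT.isUnit_sub (by simp)
  have h1 : (1 : ℂ) = star 1 := by simp
  have hw := hT.transfer_mul_conjTranspose k h1 hu hu
  have hw' := hT.transfer_mul_conjTranspose (k + 1) h1 hu hu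
  have h := hT.transfer_succ_mul k hu
  have hH := congrArg Matrix.conjTranspose h
  simp only [Matrix.conjTranspose_mul, Matrix.conjTranspose_sub, Matrix.conjTranspose_smul,
    sigJ_conjTranspose, hT.potential_conjTranspose, Matrix.conjTranspose_one, Complex.star_def,
    Complex.conj_I, one_smul, neg_smul, sub_neg_eq_add] at h hH
  -- on the real axis the transfer functions are unitary, so that
  -- `(1 - i C) (1 + i C) = W (1 - i j) (1 + i j) W^* = 2`
  have hJ2 : (1 - Complex.I • sigJ m₁ m₂) * (1 + Complex.I • sigJ m₁ m₂) = (2 : ℂ) • 1 := by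
    simp only [Matrix.mul_add, Matrix.sub_mul, Matrix.mul_smul, Matrix.smul_mul, sigJ_mul_self,
      Matrix.one_mul, Matrix.mul_one, smul_smul, smul_sub, Complex.I_mul_I]
    module
  have h2 : (1 - Complex.I • T.potential k) * (1 + Complex.I • T.potential k) = (2 : ℂ) • 1 := by
    calc _ = ((1 - Complex.I • T.potential k) * T.transfer k 1) *
          ((T.transfer k 1)ᴴ * (1 + Complex.I • T.potential k)) := by
          rw [Matrix.mul_assoc, ← Matrix.mul_assoc (T.transfer k 1), hw, Matrix.one_mul]
      _ = _ := by
          rw [← h, ← hH, Matrix.mul_assoc, ← Matrix.mul_assoc (1 - _), hJ2, Matrix.smul_mul,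
            Matrix.mul_smul, Matrix.one_mul, hw']
  simp only [Matrix.mul_add, Matrix.sub_mul, Matrix.mul_smul, Matrix.smul_mul,
      Matrix.one_mul, Matrix.mul_one, smul_smul, smul_sub, Complex.I_mul_I] at h2
  linear_combination (norm := module) h2

theorem StronglyAdmissible.trace_potential (hT : T.StronglyAdmissible) (k : ℕ) :
    (T.potential k).trace = (m₁ : ℂ) - m₂ := by
  rw [hT.potential_eq, Matrix.trace_sub, Matrix.trace_add,
    trace_of_lyapunov (hT.R_posDef k).isUnit (hT.lyapunov k),
    trace_of_lyapunov (hT.R_posDef (k + 1)).isUnit (hT.lyapunov (k + 1)), trace_sigJ]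
  ring

theorem StronglyAdmissible.isDiracPotential (hT : T.StronglyAdmissible) :
    IsDiracPotential T.potential := fun k =>
  exists_unitary_of_involution (hT.potential_conjTranspose k) (hT.potential_mul_self k)
    (hT.trace_potential k)

theorem StronglyAdmissible.tendsto_potential_inr (hT : T.StronglyAdmissible) (a : Fin m₂) :
    Tendsto (fun k => T.potential k (Sum.inr a) (Sum.inr a)) atTop (𝓝 (-1)) := by
  have h := hT.tendsto_V_mul (T.P₀ * lastCols m₁ m₂)
  have h2 : Tendsto (fun k => ((T.V k)ᴴ * (T.R k)⁻¹ * T.V k) (Sum.inr a) (Sum.inr a)) atTop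
      (𝓝 0) := by
    refine (tendsto_pi_nhds.1 (tendsto_pi_nhds.1 h (Sum.inr a)) a).congr fun k => ?_
    rw [← V_mul_lastCols k, ← Matrix.mul_assoc]
    simp [Matrix.mul_apply (N := lastCols m₁ m₂), Matrix.one_apply]
  have h3 := (tendsto_const_nhds (x := (-1 : ℂ))).add (h2.sub (h2.comp (tendsto_add_atTop_nat 1)))
  rw [sub_zero, add_zero] at h3
  refine h3.congr fun k => ?_
  rw [hT.potential_eq]
  simp only [Function.comp_apply, Matrix.sub_apply, Matrix.add_apply, sigJ,
    Matrix.fromBlocks_apply₂₂, Matrix.neg_apply, Matrix.one_apply_eq]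
  ring

/-- The potential tends to `j`: its last diagonal entries tend to `-1`, its diagonal entries are
at most `1` in absolute value and their sum is `m₁ - m₂`, and its rows are unit vectors. -/
theorem StronglyAdmissible.tendsto_potential (hT : T.StronglyAdmissible) :
    Tendsto T.potential atTop (𝓝 (sigJ m₁ m₂)) := by
  set s : Fin m₁ ⊕ Fin m₂ → ℝ := Sum.elim (fun _ => 1) (fun _ => -1) with hs
  have hrow : ∀ k i, ∑ l, ‖T.potential k i l‖ ^ 2 = 1 := by
    intro k i
    have h := congrFun (congrFun (hT.potential_mul_self k) i) i
    nth_rewrite 2 [← hT.potential_conjTranspose k] at h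
    simp only [Matrix.mul_apply, Matrix.conjTranspose_apply, Matrix.one_apply_eq,
      Complex.star_def, Complex.mul_conj'] at h
    exact_mod_cast h
  have hle : ∀ k i, (T.potential k i i).re ≤ 1 := fun k i => by
    have h1 := Finset.single_le_sum (f := fun l => ‖T.potential k i l‖ ^ 2)
      (fun _ _ => by positivity) (Finset.mem_univ i)
    simp only [hrow] at h1
    exact (Complex.re_le_norm _).trans ((sq_le_one_iff₀ (norm_nonneg _)).1 h1)
  have hinr : ∀ a, Tendsto (fun k => (T.potential k (Sum.inr a) (Sum.inr a)).re) atTop (𝓝 (-1)) :=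
    fun a => by
      have := (Complex.continuous_re.tendsto _).comp (hT.tendsto_potential_inr a)
      simpa [Function.comp_def] using this
  have hinl : ∀ a, Tendsto (fun k => (T.potential k (Sum.inl a) (Sum.inl a)).re) atTop (𝓝 1) := by
    intro a
    have h1 : Tendsto (fun k => ∑ l : Fin m₂, (1 + (T.potential k (Sum.inr l) (Sum.inr l)).re))
        atTop (𝓝 0) := by
      have := tendsto_finsetSum (Finset.univ : Finset (Fin m₂))
        (fun l _ => (tendsto_const_nhds (x := (1 : ℝ))).add (hinr l))
      simpa using this
    have h2 : ∀ k, ∑ l : Fin m₁, (1 - (T.potential k (Sum.inl l) (Sum.inl l)).re) =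
        ∑ l : Fin m₂, (1 + (T.potential k (Sum.inr l) (Sum.inr l)).re) := by
      intro k
      have h3 := congrArg Complex.re (hT.trace_potential k)
      simp only [Matrix.trace, Matrix.diag_apply, Fintype.sum_sum_type, Complex.add_re,
        Complex.re_sum, Complex.sub_re, Complex.natCast_re] at h3
      simp only [Finset.sum_sub_distrib, Finset.sum_add_distrib, Finset.sum_const, Finset.card_univ,
        Fintype.card_fin, nsmul_eq_mul, mul_one]
      linarith
    have h4 : Tendsto (fun k => 1 - (T.potential k (Sum.inl a) (Sum.inl a)).re) atTop (𝓝 0) := by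
      refine squeeze_zero (fun k => sub_nonneg.2 (hle k _)) (fun k => ?_) h1
      rw [← h2]
      exact Finset.single_le_sum (f := fun l => 1 - (T.potential k (Sum.inl l) (Sum.inl l)).re)
        (fun _ _ => sub_nonneg.2 (hle k _)) (Finset.mem_univ a)
    simpa using (tendsto_const_nhds (x := (1 : ℝ))).sub h4
  have hdiag : ∀ i, Tendsto (fun k => 2 - 2 * s i * (T.potential k i i).re) atTop (𝓝 0) := by
    rintro (a | a)
    · have := ((hinl a).const_mul (2 * s (Sum.inl a))).const_sub 2
      simpa [hs] using this
    · have := ((hinr a).const_mul (2 * s (Sum.inr a))).const_sub 2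
      simpa [hs] using this
  refine tendsto_pi_nhds.2 fun i => ?_
  have hz : Tendsto (fun k => T.potential k i - sigJ m₁ m₂ i) atTop (𝓝 0) := by
    refine tendsto_zero_of_normSq ((hdiag i).congr fun k => ?_)
    have hJ : ∀ l, ‖(T.potential k i - sigJ m₁ m₂ i) l‖ ^ 2 =
        ‖T.potential k i l‖ ^ 2 + if l = i then 1 - 2 * s i * (T.potential k i i).re else 0 := by
      intro l
      rw [Pi.sub_apply, sigJ_eq_diagonal]
      by_cases h : l = i
      · subst h
        rw [Matrix.diagonal_apply_eq, if_pos rfl, Complex.sq_norm, Complex.sq_norm,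
          Complex.normSq_apply, Complex.normSq_apply]
        rcases l with l | l <;> simp [hs] <;> ring
      · rw [Matrix.diagonal_apply_ne _ (Ne.symm h), if_neg h, sub_zero, add_zero]
    rw [normSq, Finset.sum_congr rfl (fun l _ => hJ l), Finset.sum_add_distrib, hrow,
      Finset.sum_ite_eq' Finset.univ i]
    simp
    ring
  have := hz.add_const (sigJ m₁ m₂ i)
  simpa using this

end Triple

/-! ### Norm growth and the Jost solution -/

section Step
variable {ι : Type*} [Fintype ι] [DecidableEq ι] {C : Matrix ι ι ℂ}

/-- The real part of the quadratic form `y^* C y`. -/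
noncomputable def quadRe (C : Matrix ι ι ℂ) (y : ι → ℂ) : ℝ := (star y ⬝ᵥ C *ᵥ y).re

omit [DecidableEq ι] in
theorem quadRe_add (C C' : Matrix ι ι ℂ) (y : ι → ℂ) :
    quadRe (C + C') y = quadRe C y + quadRe C' y := by
  simp [quadRe, Matrix.add_mulVec, dotProduct_add]

/-- The norm after one step of a system whose coefficient is a Hermitian involution. -/
theorem normSq_step (hC : Cᴴ = C) (hC2 : C * C = 1) (c : ℂ) (y : ι → ℂ) :
    normSq ((1 + c • C) *ᵥ y) = (1 + ‖c‖ ^ 2) * normSq y + 2 * c.re * quadRe C y := by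
  have h := normSq_mulVec (1 + c • C) y
  have h2 : (1 + c • C)ᴴ * (1 + c • C) = (1 + (‖c‖ ^ 2 : ℝ) : ℂ) • (1 : Matrix ι ι ℂ) +
      ((2 * c.re : ℝ) : ℂ) • C := by
    rw [Matrix.conjTranspose_add, Matrix.conjTranspose_smul, Matrix.conjTranspose_one, hC]
    simp only [Matrix.mul_add, Matrix.add_mul, Matrix.mul_smul, Matrix.smul_mul, hC2,
      Matrix.one_mul, Matrix.mul_one]
    have h3 : c * star c = (‖c‖ ^ 2 : ℝ) := by
      rw [Complex.star_def, Complex.mul_conj']; push_cast; rfl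
    have h4 : ((2 * c.re : ℝ) : ℂ) = c + star c := by
      rw [Complex.star_def, Complex.add_conj]
    rw [← h3, h4]; module
  rw [h2, Matrix.add_mulVec (_ • _), Matrix.smul_mulVec, Matrix.smul_mulVec, Matrix.one_mulVec,
    dotProduct_add, dotProduct_smul, dotProduct_smul, star_dotProduct_self] at h
  have h5 := congrArg Complex.re h
  simp only [Complex.ofReal_re, Complex.add_re, smul_eq_mul, Complex.re_ofReal_mul] at h5
  rw [h5, quadRe, ← Complex.ofReal_one, ← Complex.ofReal_add, ← Complex.ofReal_mul,
    Complex.ofReal_re]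

theorem quadRe_step (hC : Cᴴ = C) (hC2 : C * C = 1) (c : ℂ) (y : ι → ℂ) :
    quadRe C ((1 + c • C) *ᵥ y) = (1 + ‖c‖ ^ 2) * quadRe C y + 2 * c.re * normSq y := by
  have h2 : (1 + c • C)ᴴ * C * (1 + c • C) = (1 + (‖c‖ ^ 2 : ℝ) : ℂ) • C +
      ((2 * c.re : ℝ) : ℂ) • (1 : Matrix ι ι ℂ) := by
    rw [Matrix.conjTranspose_add, Matrix.conjTranspose_smul, Matrix.conjTranspose_one, hC]
    simp only [Matrix.mul_add, Matrix.add_mul, Matrix.mul_smul, Matrix.smul_mul, hC2,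
      Matrix.one_mul, Matrix.mul_one]
    have h3 : c * star c = (‖c‖ ^ 2 : ℝ) := by
      rw [Complex.star_def, Complex.mul_conj']; push_cast; rfl
    have h4 : ((2 * c.re : ℝ) : ℂ) = c + star c := by
      rw [Complex.star_def, Complex.add_conj]
    rw [← h3, h4]; module
  have h : star ((1 + c • C) *ᵥ y) ⬝ᵥ C *ᵥ ((1 + c • C) *ᵥ y) =
      star y ⬝ᵥ ((1 + c • C)ᴴ * C * (1 + c • C)) *ᵥ y := by
    rw [Matrix.star_mulVec, ← Matrix.dotProduct_mulVec, Matrix.mulVec_mulVec, Matrix.mulVec_mulVec,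
      Matrix.mul_assoc]
  rw [h2, Matrix.add_mulVec (_ • _), Matrix.smul_mulVec, Matrix.smul_mulVec, Matrix.one_mulVec,
    dotProduct_add, dotProduct_smul, dotProduct_smul, star_dotProduct_self] at h
  have h5 := congrArg Complex.re h
  simp only [Complex.add_re, smul_eq_mul, Complex.re_ofReal_mul, Complex.ofReal_re] at h5
  rw [quadRe, h5, quadRe, ← Complex.ofReal_one, ← Complex.ofReal_add, Complex.re_ofReal_mul]

theorem neg_normSq_le_quadRe (hC : Cᴴ = C) (hC2 : C * C = 1) (y : ι → ℂ) :
    -normSq y ≤ quadRe C y := by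
  have h := normSq_step hC hC2 1 y
  have h2 := normSq_nonneg ((1 + (1 : ℂ) • C) *ᵥ y)
  rw [h] at h2
  simp at h2
  linarith

/-- One step of the system with parameter `c = i/z`, `Im z ≥ 0`, multiplies norms at least by
`|1 - c|`. -/
theorem le_normSq_step (hC : Cᴴ = C) (hC2 : C * C = 1) {c : ℂ} (hc : 0 ≤ c.re) (y : ι → ℂ) :
    ‖1 - c‖ ^ 2 * normSq y ≤ normSq ((1 + c • C) *ᵥ y) := by
  rw [normSq_step hC hC2]
  have h : ‖1 - c‖ ^ 2 = 1 + ‖c‖ ^ 2 - 2 * c.re := by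
    rw [Complex.sq_norm, Complex.sq_norm, Complex.normSq_apply, Complex.normSq_apply]
    simp; ring
  rw [h]
  nlinarith [neg_normSq_le_quadRe hC hC2 y]

end Step

theorem I_div_re (z : ℂ) : (Complex.I / z).re = z.im / ‖z‖ ^ 2 := by
  rw [Complex.div_re, Complex.sq_norm]; simp

section Jost
variable {m₁ m₂ n : ℕ} {T : Triple m₁ m₂ n}
namespace Triple

theorem StronglyAdmissible.transfer_succ_mul' (hT : T.StronglyAdmissible) (k : ℕ) {z : ℂ}
    (hz : z ≠ 0) (hl : IsUnit (T.A - (-z) • 1)) :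
    T.transfer (k + 1) (-z) * (1 + (Complex.I / z) • sigJ m₁ m₂) =
      (1 + (Complex.I / z) • T.potential k) * T.transfer k (-z) := by
  have h := congrArg (fun M => (-z)⁻¹ • M) (hT.transfer_succ_mul k hl)
  rw [← Matrix.mul_smul, ← Matrix.smul_mul] at h
  simp only [smul_sub, smul_smul] at h
  have h1 : (-z)⁻¹ * -z = 1 := inv_mul_cancel₀ (neg_ne_zero.2 hz)
  have h2 : (-z)⁻¹ * Complex.I = -(Complex.I / z) := by rw [inv_neg]; ring
  simpa only [h1, h2, one_smul, neg_smul, sub_neg_eq_add] using h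

theorem StronglyAdmissible.fundSol_mul_transfer (hT : T.StronglyAdmissible) (k : ℕ) {z : ℂ}
    (hz : z ≠ 0) (hl : IsUnit (T.A - (-z) • 1)) :
    fundSol T.potential z k * T.transfer 0 (-z) =
      T.transfer k (-z) * (1 + (Complex.I / z) • sigJ m₁ m₂) ^ k := by
  induction k with
  | zero => simp [fundSol]
  | succ k ih =>
    rw [fundSol, Matrix.mul_assoc, ih, ← Matrix.mul_assoc, ← hT.transfer_succ_mul' k hz hl,
      Matrix.mul_assoc, pow_succ']

theorem pow_mul_lastCols (c : ℂ) (k : ℕ) :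
    (1 + c • sigJ m₁ m₂) ^ k * lastCols m₁ m₂ = (1 - c) ^ k • lastCols m₁ m₂ := by
  have h : (1 + c • sigJ m₁ m₂) * lastCols m₁ m₂ = (1 - c) • lastCols m₁ m₂ := by
    have h1 := one_add_sigJ_mul_lastCols (m₁ := m₁) (m₂ := m₂)
    rw [Matrix.add_mul, Matrix.one_mul] at h1
    rw [Matrix.add_mul, Matrix.one_mul, Matrix.smul_mul, eq_neg_of_add_eq_zero_right h1]
    module
  induction k with
  | zero => simp
  | succ k ih =>
    rw [pow_succ, Matrix.mul_assoc, h, Matrix.mul_smul, ih, smul_smul, pow_succ']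

variable (T) in
/-- The Jost solution, obtained from the transfer functions. -/
noncomputable def jost (z : ℂ) (k : ℕ) : Matrix (Fin m₁ ⊕ Fin m₂) (Fin m₂) ℂ :=
  (1 - Complex.I / z) ^ k • (T.transfer k (-z) * lastCols m₁ m₂)

theorem StronglyAdmissible.fundSol_mul_jost (hT : T.StronglyAdmissible) (k : ℕ) {z : ℂ}
    (hz : z ≠ 0) (hl : IsUnit (T.A - (-z) • 1)) :
    fundSol T.potential z k * T.jost z 0 = T.jost z k := by
  rw [jost, pow_zero, one_smul, ← Matrix.mul_assoc, hT.fundSol_mul_transfer k hz hl,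
    Matrix.mul_assoc, pow_mul_lastCols, Matrix.mul_smul, jost]

theorem StronglyAdmissible.isJostSolution_jost (hT : T.StronglyAdmissible) {z : ℂ}
    (hz : z ≠ 0) (hl : IsUnit (T.A - (-z) • 1)) :
    IsJostSolution T.potential z (T.jost z) := by
  refine ⟨fun k => ?_, _, hT.tendsto_transfer hl, fun k => rfl⟩
  rw [← hT.fundSol_mul_jost (k + 1) hz hl, fundSol, Matrix.mul_assoc,
    hT.fundSol_mul_jost k hz hl]

theorem jost_zero (z : ℂ) :
    T.jost z 0 = Matrix.fromRows (T.b (-z)) (T.d (-z)) := by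
  rw [jost, pow_zero, one_smul, b, d]
  conv_lhs => rw [← Matrix.fromBlocks_toBlocks (T.transfer 0 (-z))]
  rw [Matrix.fromBlocks_mul_fromRows]
  simp

end Triple

/-- In the closed upper half-plane no nonzero solution is `o((1 - i/z)^k)`, because one step of the
system multiplies the norm at least by `|1 - i/z|`. -/
theorem IsJostSolution.unique {C : ℕ → BlockMat m₁ m₂} (hC : ∀ k, (C k)ᴴ = C k)
    (hC2 : ∀ k, C k * C k = 1) {z : ℂ} (hz : 0 ≤ z.im) (hz0 : z ≠ 0) (hzI : z ≠ Complex.I)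
    {Y Y' : ℕ → Matrix (Fin m₁ ⊕ Fin m₂) (Fin m₂) ℂ} (hY : IsJostSolution C z Y)
    (hY' : IsJostSolution C z Y') : Y = Y' := by
  have hc : 0 ≤ (Complex.I / z).re := by rw [I_div_re]; positivity
  have hβ : 1 - Complex.I / z ≠ 0 := by
    rw [sub_ne_zero]
    exact fun h => hzI ((eq_div_iff hz0).1 h ▸ (one_mul z).symm)
  obtain ⟨hS, E, hE, hYE⟩ := hY
  obtain ⟨hS', E', hE', hYE'⟩ := hY'
  have h0 : Y 0 = Y' 0 := by
    ext i l
    let y : ℕ → (Fin m₁ ⊕ Fin m₂) → ℂ := fun k x => Y k x l - Y' k x l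
    have hstep : ∀ k, y (k + 1) = (1 + (Complex.I / z) • C k) *ᵥ y k := by
      intro k
      have h : Y (k + 1) - Y' (k + 1) = (1 + (Complex.I / z) • C k) * (Y k - Y' k) := by
        rw [hS, hS', Matrix.mul_sub]
      ext x
      exact congrFun (congrFun h x) l
    have hgrow : ∀ k, ‖(1 - Complex.I / z) ^ k‖ ^ 2 * normSq (y 0) ≤ normSq (y k) := by
      intro k
      induction k with
      | zero => simp
      | succ k ih =>
        rw [hstep, pow_succ (1 - _), norm_mul, mul_pow, mul_comm _ (‖1 - _‖ ^ 2), mul_assoc]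
        exact (mul_le_mul_of_nonneg_left ih (by positivity)).trans
          (le_normSq_step (hC k) (hC2 k) hc _)
    let e : ℕ → (Fin m₁ ⊕ Fin m₂) → ℂ := fun k x => E k x l - E' k x l
    have hy : ∀ k, y k = (1 - Complex.I / z) ^ k • e k := by
      intro k
      ext x
      simp only [y, e, hYE, hYE', Matrix.smul_apply, Pi.smul_apply, smul_eq_mul]; ring
    have he : Tendsto (fun k => normSq (e k)) atTop (𝓝 0) := by
      have h1 : Tendsto e atTop (𝓝 0) := by
        refine tendsto_pi_nhds.2 fun x => ?_
        have := (tendsto_pi_nhds.1 (tendsto_pi_nhds.1 hE x) l).sub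
          (tendsto_pi_nhds.1 (tendsto_pi_nhds.1 hE' x) l)
        rw [sub_self] at this
        exact this
      have := (continuous_normSq.tendsto (0 : (Fin m₁ ⊕ Fin m₂) → ℂ)).comp h1
      rw [normSq_zero] at this
      exact this
    have h2 : normSq (y 0) ≤ 0 := by
      refine ge_of_tendsto' he fun k => ?_
      have h3 := hgrow k
      rw [hy k, normSq_smul] at h3
      have h4 : 0 < ‖(1 - Complex.I / z) ^ k‖ ^ 2 := by
        have := norm_pos_iff.2 (pow_ne_zero k hβ)
        positivity
      exact le_of_mul_le_mul_left h3 h4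
    have h5 := congrFun (normSq_eq_zero.1 (h2.antisymm (normSq_nonneg _))) i
    exact sub_eq_zero.1 h5
  funext k
  induction k with
  | zero => exact h0
  | succ k ih => rw [hS, hS', ih]

end Jost

/-! ### Rationality of `b d⁻¹` -/

section Rational

theorem ratFunc_eval_div (p q : Polynomial ℂ) {z : ℂ} (hz : q.eval z ≠ 0) :
    (algebraMap (Polynomial ℂ) (RatFunc ℂ) p / algebraMap _ _ q).denom.eval z ≠ 0 ∧
      RatFunc.eval (RingHom.id ℂ) z (algebraMap (Polynomial ℂ) (RatFunc ℂ) p / algebraMap _ _ q) =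
        p.eval z / q.eval z := by
  have hq : q ≠ 0 := by rintro rfl; simp at hz
  set x := algebraMap (Polynomial ℂ) (RatFunc ℂ) p / algebraMap _ _ q with hx
  have hd : x.denom.eval z ≠ 0 := fun h =>
    hz (Polynomial.eval_eq_zero_of_dvd_of_eval_eq_zero (RatFunc.denom_div_dvd p q) h)
  refine ⟨hd, ?_⟩
  have h := congrArg (Polynomial.eval z) ((RatFunc.num_mul_eq_mul_denom_iff hq).2 hx)
  rw [Polynomial.eval_mul, Polynomial.eval_mul] at h
  rw [RatFunc.eval, Polynomial.eval₂_id, Polynomial.eval₂_id, div_eq_div_iff hd hz, h]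

/-- Realizations `G (M + z)⁻¹ H` are rational matrix functions. -/
theorem exists_rational_realization {p q n : ℕ} (G : Matrix (Fin p) (Fin n) ℂ)
    (M : Matrix (Fin n) (Fin n) ℂ) (H : Matrix (Fin n) (Fin q) ℂ) :
    ∃ F : Matrix (Fin p) (Fin q) (RatFunc ℂ), ∀ z : ℂ, IsUnit (M + z • 1) →
      RegularAt F z ∧ ratEval F z = G * (M + z • 1)⁻¹ * H := by
  let Mp : Matrix (Fin n) (Fin n) (Polynomial ℂ) :=
    Polynomial.C.mapMatrix M + (Polynomial.X : Polynomial ℂ) • 1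
  let Np : Matrix (Fin p) (Fin q) (Polynomial ℂ) :=
    G.map Polynomial.C * Mp.adjugate * H.map Polynomial.C
  have hMp : ∀ z, (Polynomial.evalRingHom z).mapMatrix Mp = M + z • 1 := by
    intro z
    ext i l
    by_cases h : i = l <;> simp [Mp, h]
  have hNp : ∀ z, Np.map (Polynomial.evalRingHom z) = G * (M + z • 1).adjugate * H := by
    intro z
    have hC : ∀ {r s : ℕ} (B : Matrix (Fin r) (Fin s) ℂ),
        (B.map Polynomial.C).map (Polynomial.evalRingHom z) = B := fun B => by
      ext i l; simp
    rw [Matrix.map_mul, Matrix.map_mul, hC, hC, ← hMp z, ← RingHom.map_adjugate]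
    rfl
  refine ⟨Np.map fun r => algebraMap _ (RatFunc ℂ) r / algebraMap _ (RatFunc ℂ) Mp.det, ?_⟩
  intro z hz
  have hdet : Mp.det.eval z = (M + z • 1).det := by
    rw [← hMp z, ← RingHom.map_det]; rfl
  have hne : Mp.det.eval z ≠ 0 := by
    rw [hdet]; exact ((Matrix.isUnit_iff_isUnit_det _).1 hz).ne_zero
  refine ⟨fun i l => (ratFunc_eval_div _ _ hne).1, ?_⟩
  ext i l
  rw [Matrix.inv_def, Matrix.mul_smul, Matrix.smul_mul, ← hNp z, Ring.inverse_eq_inv', ← hdet]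
  simp only [ratEval, Matrix.map_apply, Matrix.smul_apply, smul_eq_mul]
  rw [(ratFunc_eval_div _ _ hne).2, div_eq_inv_mul]
  rfl

variable {ι κ κ' : Type*} [Fintype ι] [DecidableEq ι] [Fintype κ] [DecidableEq κ]
  {N : Matrix ι ι ℂ}

/-- State-space inversion of `1 - i G N⁻¹ H`. -/
theorem isUnit_one_sub_iff (hN : IsUnit N) (G : Matrix κ ι ℂ) (H : Matrix ι κ ℂ) :
    IsUnit (1 - Complex.I • (G * N⁻¹ * H)) ↔ IsUnit (N - Complex.I • (H * G)) := by
  have hu : IsUnit N.det := (Matrix.isUnit_iff_isUnit_det _).1 hN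
  have h1 : (1 - Complex.I • (G * N⁻¹ * H)).det = (1 - (Complex.I • (N⁻¹ * H)) * G).det := by
    rw [← Matrix.det_one_sub_mul_comm, Matrix.mul_smul, Matrix.mul_assoc]
  have h2 : N * (1 - (Complex.I • (N⁻¹ * H)) * G) = N - Complex.I • (H * G) := by
    rw [Matrix.mul_sub, Matrix.mul_one, Matrix.smul_mul, Matrix.mul_smul, ← Matrix.mul_assoc,
      ← Matrix.mul_assoc, Matrix.mul_nonsing_inv _ hu, Matrix.one_mul]
  rw [Matrix.isUnit_iff_isUnit_det, Matrix.isUnit_iff_isUnit_det, h1, ← h2, Matrix.det_mul]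
  rw [IsUnit.mul_iff]
  exact ⟨fun h => ⟨hu, h⟩, fun h => h.2⟩

theorem mul_inv_one_sub (hN : IsUnit N) (G : Matrix κ ι ℂ) (H : Matrix ι κ ℂ)
    (hd : IsUnit (1 - Complex.I • (G * N⁻¹ * H))) (G' : Matrix κ' ι ℂ) :
    G' * N⁻¹ * H * (1 - Complex.I • (G * N⁻¹ * H))⁻¹ = G' * (N - Complex.I • (H * G))⁻¹ * H := by
  have hu : IsUnit N.det := (Matrix.isUnit_iff_isUnit_det _).1 hN
  have hK := (isUnit_one_sub_iff hN G H).1 hd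
  have hKu : IsUnit (N - Complex.I • (H * G)).det := (Matrix.isUnit_iff_isUnit_det _).1 hK
  have hdu := (Matrix.isUnit_iff_isUnit_det _).1 hd
  have h1 : (N - Complex.I • (H * G)) * (N⁻¹ * H) = H * (1 - Complex.I • (G * N⁻¹ * H)) := by
    rw [Matrix.sub_mul, Matrix.mul_sub, ← Matrix.mul_assoc N, Matrix.mul_nonsing_inv _ hu,
      Matrix.one_mul, Matrix.mul_one, Matrix.smul_mul, Matrix.mul_smul]
    simp only [Matrix.mul_assoc]
  have h2 : N⁻¹ * H = (N - Complex.I • (H * G))⁻¹ * (H * (1 - Complex.I • (G * N⁻¹ * H))) := by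
    rw [← h1, ← Matrix.mul_assoc, Matrix.nonsing_inv_mul _ hKu, Matrix.one_mul]
  conv_lhs => rw [Matrix.mul_assoc G', h2, Matrix.mul_assoc G', Matrix.mul_assoc, Matrix.mul_assoc,
    Matrix.mul_nonsing_inv _ hdu, Matrix.mul_one, ← Matrix.mul_assoc]

end Rational

namespace Triple
variable {m₁ m₂ n : ℕ} {T : Triple m₁ m₂ n}

variable (T) in
/-- The state matrix `A - i ϑ₂ ϑ₂^* S₀⁻¹` of `b d⁻¹`. -/
noncomputable def crossA : Matrix (Fin n) (Fin n) ℂ :=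
  T.A - Complex.I • (T.P₀.toCols₂ * (T.P₀ᴴ * T.S₀⁻¹).toRows₂)

theorem b_eq (lam : ℂ) : T.b lam =
    -Complex.I • ((T.P₀ᴴ * T.S₀⁻¹).toRows₁ * (T.A - lam • 1)⁻¹ * T.P₀.toCols₂) := by
  ext i l
  simp [b, transfer, P, S, Matrix.toBlocks₁₂, Matrix.mul_apply, Matrix.toRows₁, Matrix.toCols₂]

theorem d_eq (lam : ℂ) : T.d lam =
    1 - Complex.I • ((T.P₀ᴴ * T.S₀⁻¹).toRows₂ * (T.A - lam • 1)⁻¹ * T.P₀.toCols₂) := by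
  ext i l
  simp [d, transfer, P, S, Matrix.toBlocks₂₂, Matrix.mul_apply, Matrix.toRows₂, Matrix.toCols₂,
    Matrix.one_apply]

/-- Off the spectrum of `A`, the block `d` is singular exactly at the eigenvalues of `crossA`. -/
theorem isUnit_d_iff {lam : ℂ} (hl : IsUnit (T.A - lam • 1)) :
    IsUnit (T.d lam) ↔ IsUnit (T.crossA - lam • 1) := by
  rw [d_eq, isUnit_one_sub_iff hl, crossA, sub_right_comm]

theorem b_mul_inv_d {lam : ℂ} (hl : IsUnit (T.A - lam • 1)) (hd : IsUnit (T.d lam)) :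
    T.b lam * (T.d lam)⁻¹ =
      -Complex.I • (T.P₀ᴴ * T.S₀⁻¹).toRows₁ * (T.crossA - lam • 1)⁻¹ * T.P₀.toCols₂ := by
  rw [d_eq] at hd
  rw [b_eq, d_eq, Matrix.smul_mul, mul_inv_one_sub hl _ _ hd, crossA, sub_right_comm,
    Matrix.smul_mul, Matrix.smul_mul]

variable (T) in
theorem finite_exceptional :
    {z : ℂ | -z ∈ spectrum ℂ T.A ∨ ¬ IsUnit (T.d (-z))}.Finite := by
  have h : ((fun z : ℂ => -z) ⁻¹' (spectrum ℂ T.A ∪ spectrum ℂ T.crossA)).Finite :=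
    ((Matrix.finite_spectrum T.A).union (Matrix.finite_spectrum T.crossA)).preimage
      neg_injective.injOn
  refine h.subset fun z hz => ?_
  by_cases h1 : -z ∈ spectrum ℂ T.A
  · exact Or.inl h1
  · refine Or.inr ?_
    by_contra h2
    exact hz.resolve_left h1
      ((isUnit_d_iff (notMem_spectrum_iff.1 h1)).2 (notMem_spectrum_iff.1 h2))

variable (T) in
theorem exists_rational : ∃ F : Matrix (Fin m₁) (Fin m₂) (RatFunc ℂ),
    ∀ z : ℂ, -z ∉ spectrum ℂ T.A → IsUnit (T.d (-z)) →
      RegularAt F z ∧ ratEval F z = T.b (-z) * (T.d (-z))⁻¹ := by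
  obtain ⟨F, hF⟩ := exists_rational_realization (-Complex.I • (T.P₀ᴴ * T.S₀⁻¹).toRows₁) T.crossA
    T.P₀.toCols₂
  refine ⟨F, fun z hz hd => ?_⟩
  have hl := notMem_spectrum_iff.1 hz
  have hc := (isUnit_d_iff hl).1 hd
  rw [b_mul_inv_d hl hd]
  have he : T.crossA - (-z) • 1 = T.crossA + z • 1 := by rw [neg_smul, sub_neg_eq_add]
  rw [he] at hc ⊢
  exact hF z hc

end Triple

/-! ### Weyl functions -/

section System
variable {m₁ m₂ : ℕ} {C : ℕ → BlockMat m₁ m₂} {z : ℂ}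

theorem fundSol_succ_mulVec (k : ℕ) (g : Fin m₁ ⊕ Fin m₂ → ℂ) :
    fundSol C z (k + 1) *ᵥ g = (1 + (Complex.I / z) • C k) *ᵥ (fundSol C z k *ᵥ g) := by
  rw [fundSol, Matrix.mulVec_mulVec]

theorem le_normSq_fundSol (hC : ∀ k, (C k)ᴴ = C k) (hC2 : ∀ k, C k * C k = 1) (hz : 0 ≤ z.im)
    (k : ℕ) (g : Fin m₁ ⊕ Fin m₂ → ℂ) :
    ‖(1 - Complex.I / z) ^ k‖ ^ 2 * normSq g ≤ normSq (fundSol C z k *ᵥ g) := by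
  have hc : 0 ≤ (Complex.I / z).re := by rw [I_div_re]; positivity
  induction k with
  | zero => simp [fundSol]
  | succ k ih =>
    rw [fundSol_succ_mulVec, pow_succ (1 - _), norm_mul, mul_pow, mul_comm _ (‖1 - _‖ ^ 2),
      mul_assoc]
    exact (mul_le_mul_of_nonneg_left ih (by positivity)).trans
      (le_normSq_step (hC k) (hC2 k) hc _)

/-- If `C_k` and `C_{k+1}` are close, the form `y_k^* C_k y_k` does not turn negative in one
step: the factor on the left is nonnegative, and it vanishes for `c = 1`. The bound on `C_{k+1} - C_k` is the
one for which the terms with the norm of `y` cancel. -/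
theorem le_quadRe_succ (hC : ∀ k, (C k)ᴴ = C k) (hC2 : ∀ k, C k * C k = 1) {c : ℂ} (k : ℕ)
    (hk : ∑ i, ∑ l, ‖(C (k + 1) - C k) i l‖ ≤ 2 * c.re / (1 + ‖c‖ ^ 2))
    (y : Fin m₁ ⊕ Fin m₂ → ℂ) :
    (1 + ‖c‖ ^ 2 - (2 * c.re) ^ 2 / (1 + ‖c‖ ^ 2)) * quadRe (C k) y ≤
      quadRe (C (k + 1)) ((1 + c • C k) *ᵥ y) := by
  set y' := (1 + c • C k) *ᵥ y with hy'
  set δ := 2 * c.re / (1 + ‖c‖ ^ 2) with hδ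
  have hpos : 0 < 1 + ‖c‖ ^ 2 := by positivity
  have h1 : quadRe (C (k + 1)) y' = quadRe (C k) y' + quadRe (C (k + 1) - C k) y' := by
    rw [← quadRe_add, add_sub_cancel]
  have h2 : |quadRe (C (k + 1) - C k) y'| ≤ δ * normSq y' :=
    (Complex.abs_re_le_norm _).trans ((norm_quadForm_le _ _).trans
      (mul_le_mul_of_nonneg_right hk (normSq_nonneg _)))
  have h3 := (abs_le.1 h2).1
  rw [h1]
  rw [hy', normSq_step (hC k) (hC2 k), ← hy'] at h3
  have h4 := quadRe_step (hC k) (hC2 k) c y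
  rw [← hy'] at h4
  rw [h4]
  have h5 : δ * (1 + ‖c‖ ^ 2) = 2 * c.re := div_mul_cancel₀ _ hpos.ne'
  have h6 : (2 * c.re) ^ 2 / (1 + ‖c‖ ^ 2) = δ * (2 * c.re) := by rw [hδ]; ring
  rw [h6]
  have h7 : δ * ((1 + ‖c‖ ^ 2) * normSq y + 2 * c.re * quadRe (C k) y) =
      2 * c.re * normSq y + δ * (2 * c.re) * quadRe (C k) y := by
    rw [mul_add, ← mul_assoc, h5]; ring
  rw [h7] at h3
  linarith

theorem two_mul_re_le (c : ℂ) : 2 * c.re ≤ 1 + ‖c‖ ^ 2 := by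
  rw [Complex.sq_norm, Complex.normSq_apply]
  nlinarith [sq_nonneg (c.re - 1), sq_nonneg c.im]

/-- A decaying solution vanishes as soon as the form `y_k^* C_k y_k` is nonnegative for some large
`k`: the form then stays nonnegative, and the norm does not decrease. -/
theorem fundSol_mulVec_eq_zero (hC : ∀ k, (C k)ᴴ = C k) (hC2 : ∀ k, C k * C k = 1)
    (hz : 0 < z.im) {K : ℕ}
    (hK : ∀ k ≥ K, ∑ i, ∑ l, ‖(C (k + 1) - C k) i l‖ ≤
      2 * (Complex.I / z).re / (1 + ‖Complex.I / z‖ ^ 2))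
    {g : Fin m₁ ⊕ Fin m₂ → ℂ}
    (hg : Tendsto (fun k => fundSol C z k *ᵥ g) atTop (𝓝 0)) {k₀ : ℕ} (hk₀ : K ≤ k₀)
    (h0 : 0 ≤ quadRe (C k₀) (fundSol C z k₀ *ᵥ g)) : fundSol C z k₀ *ᵥ g = 0 := by
  have hc : 0 ≤ (Complex.I / z).re := by rw [I_div_re]; positivity
  set c := Complex.I / z with hcdef
  have hfac : 0 ≤ 1 + ‖c‖ ^ 2 - (2 * c.re) ^ 2 / (1 + ‖c‖ ^ 2) := by
    have h := two_mul_re_le c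
    rw [sub_nonneg, div_le_iff₀ (by positivity)]
    nlinarith
  have hall : ∀ j, 0 ≤ quadRe (C (k₀ + j)) (fundSol C z (k₀ + j) *ᵥ g) ∧
      normSq (fundSol C z k₀ *ᵥ g) ≤ normSq (fundSol C z (k₀ + j) *ᵥ g) := by
    intro j
    induction j with
    | zero => exact ⟨h0, le_rfl⟩
    | succ j ih =>
      have h1 := le_quadRe_succ hC hC2 (k₀ + j) (hK _ (by omega)) (fundSol C z (k₀ + j) *ᵥ g)
      have h2 := normSq_step (hC (k₀ + j)) (hC2 (k₀ + j)) c (fundSol C z (k₀ + j) *ᵥ g)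
      rw [hcdef, ← fundSol_succ_mulVec, ← hcdef] at h1 h2
      refine ⟨(mul_nonneg hfac ih.1).trans h1, ih.2.trans ?_⟩
      rw [← add_assoc, h2]
      have := mul_nonneg hc ih.1
      have := mul_nonneg (sq_nonneg ‖c‖) (normSq_nonneg (fundSol C z (k₀ + j) *ᵥ g))
      nlinarith
  have h1 : Tendsto (fun j => normSq (fundSol C z (k₀ + j) *ᵥ g)) atTop (𝓝 0) := by
    have h2 := (continuous_normSq.tendsto (0 : Fin m₁ ⊕ Fin m₂ → ℂ)).comp hg
    rw [normSq_zero] at h2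
    refine (h2.comp (tendsto_add_atTop_nat k₀)).congr fun j => ?_
    simp [add_comm]
  exact normSq_eq_zero.1 ((ge_of_tendsto' h1 fun j => (hall j).2).antisymm (normSq_nonneg _))

theorem norm_one_sub_I_div_lt_one (hz : 1 / 2 < z.im) : ‖1 - Complex.I / z‖ < 1 := by
  have hz0 : z ≠ 0 := by rintro rfl; norm_num at hz
  have hpos : 0 < ‖z‖ ^ 2 := by have := norm_pos_iff.2 hz0; positivity
  rw [← sq_lt_one_iff₀ (norm_nonneg _)]
  have h : ‖1 - Complex.I / z‖ ^ 2 = 1 + (‖z‖ ^ 2)⁻¹ - 2 * (Complex.I / z).re := by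
    have h2 : (‖z‖ ^ 2)⁻¹ = ‖Complex.I / z‖ ^ 2 := by simp
    rw [h2, Complex.sq_norm, Complex.sq_norm, Complex.normSq_apply, Complex.normSq_apply,
      Complex.sub_re, Complex.sub_im, Complex.one_re, Complex.one_im]
    ring
  rw [h, I_div_re, div_eq_mul_inv]
  nlinarith [inv_pos.2 hpos]

theorem IsWeylFunction.tendsto {M : ℝ} {φ : ℂ → Matrix (Fin m₁) (Fin m₂) ℂ}
    (h : IsWeylFunction C M φ) (hz : M < z.im) (l : Fin m₂) :
    Tendsto (fun k => fundSol C z k *ᵥ fun i =>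
      Matrix.fromRows (φ z) (1 : Matrix (Fin m₂) (Fin m₂) ℂ) i l) atTop (𝓝 0) := by
  have h1 := (Pi.summable.1 (Pi.summable.1 (h.2 z hz) l) l).tendsto_atTop_zero
  refine tendsto_zero_of_normSq ?_
  have h2 := (Complex.continuous_re.tendsto _).comp h1
  rw [Complex.zero_re] at h2
  refine h2.congr fun k => ?_
  simp only [Function.comp_apply]
  rw [Matrix.mul_assoc, ← Matrix.conjTranspose_mul]
  rw [Matrix.mul_apply, Complex.re_sum]
  refine Finset.sum_congr rfl fun i _ => ?_
  rw [Matrix.conjTranspose_apply, Complex.star_def, Complex.conj_mul']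
  rw [← Complex.ofReal_pow, Complex.ofReal_re]
  rfl

/-- There are no Weyl functions on half-planes `Im z > M` with `M < 1/2`, since at `z = i/2` the
norms of solutions do not decrease. -/
theorem IsWeylFunction.half_le (hC : ∀ k, (C k)ᴴ = C k) (hC2 : ∀ k, C k * C k = 1)
    (hm₂ : 0 < m₂) {M : ℝ} {φ : ℂ → Matrix (Fin m₁) (Fin m₂) ℂ} (h : IsWeylFunction C M φ) :
    1 / 2 ≤ M := by
  by_contra! hM
  have him : (Complex.I / 2).im = 1 / 2 := by simp
  let l : Fin m₂ := ⟨0, hm₂⟩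
  have h1 := h.tendsto (z := Complex.I / 2) (by rw [him]; exact hM) l
  set g := fun i => Matrix.fromRows (φ (Complex.I / 2)) (1 : Matrix (Fin m₂) (Fin m₂) ℂ) i l with hg
  have h2 := (continuous_normSq.tendsto (0 : Fin m₁ ⊕ Fin m₂ → ℂ)).comp h1
  rw [normSq_zero] at h2
  have h3 : normSq g ≤ 0 := by
    refine ge_of_tendsto' h2 fun k => ?_
    have h4 := le_normSq_fundSol hC hC2 (z := Complex.I / 2) (by rw [him]; norm_num) k g
    have h5 : ‖(1 - Complex.I / (Complex.I / 2)) ^ k‖ ^ 2 = 1 := by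
      have : 1 - Complex.I / (Complex.I / 2) = -1 := by field_simp; norm_num
      rw [this, norm_pow, norm_neg, norm_one, one_pow, one_pow]
    rw [h5, one_mul] at h4
    exact h4
  have h6 := sq_norm_apply_le_normSq g (Sum.inr l)
  simp only [hg, Matrix.fromRows_apply_inr, Matrix.one_apply_eq, norm_one] at h6 h3
  linarith

end System

namespace Triple
variable {m₁ m₂ n : ℕ} {T : Triple m₁ m₂ n}

theorem StronglyAdmissible.exists_small_steps (hT : T.StronglyAdmissible) {ε : ℝ} (hε : 0 < ε) :
    ∃ K, ∀ k ≥ K, ∑ i, ∑ l, ‖(T.potential (k + 1) - T.potential k) i l‖ ≤ ε := by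
  have h1 := (hT.tendsto_potential.comp (tendsto_add_atTop_nat 1)).sub hT.tendsto_potential
  rw [sub_self] at h1
  have h2 : Tendsto (fun k => ∑ i, ∑ l, ‖(T.potential (k + 1) - T.potential k) i l‖) atTop
      (𝓝 0) := by
    have := tendsto_finsetSum Finset.univ fun i (_ : i ∈ Finset.univ) =>
      tendsto_finsetSum Finset.univ fun l (_ : l ∈ Finset.univ) =>
        (tendsto_pi_nhds.1 (tendsto_pi_nhds.1 h1 i) l).norm
    simpa using this
  exact eventually_atTop.1 ((h2.eventually_lt_const hε).mono fun k hk => hk.le)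

theorem StronglyAdmissible.tendsto_jost_mulVec (hT : T.StronglyAdmissible) {z : ℂ}
    (hz : 1 / 2 < z.im) (x : Fin m₂ → ℂ) :
    Tendsto (fun k => fundSol T.potential z k *ᵥ (T.jost z 0 *ᵥ x)) atTop (𝓝 0) := by
  have hz0 : z ≠ 0 := by rintro rfl; norm_num at hz
  have hl : IsUnit (T.A - (-z) • 1) := hT.isUnit_sub (by rw [Complex.neg_im]; linarith)
  have h1 := (tendsto_pow_atTop_nhds_zero_of_norm_lt_one (norm_one_sub_I_div_lt_one hz)).smul
    (hT.tendsto_transfer hl)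
  rw [zero_smul] at h1
  have hcont : Continuous fun Y : Matrix (Fin m₁ ⊕ Fin m₂) (Fin m₂) ℂ => Y *ᵥ x := by fun_prop
  have h2 := (hcont.tendsto 0).comp h1
  rw [Matrix.zero_mulVec] at h2
  refine h2.congr fun k => ?_
  rw [Matrix.mulVec_mulVec, hT.fundSol_mul_jost k hz0 hl]
  rfl

theorem StronglyAdmissible.eq_zero_of_jost_mulVec (hT : T.StronglyAdmissible) {z : ℂ}
    (hz0 : z ≠ 0) (hzI : z ≠ Complex.I) (hl : IsUnit (T.A - (-z) • 1)) {x : Fin m₂ → ℂ}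
    (hx : T.jost z 0 *ᵥ x = 0) : x = 0 := by
  have hβ : 1 - Complex.I / z ≠ 0 := by
    rw [sub_ne_zero]
    exact fun h => hzI ((eq_div_iff hz0).1 h ▸ (one_mul z).symm)
  have h1 : ∀ k, (T.transfer k (-z) * lastCols m₁ m₂) *ᵥ x = 0 := by
    intro k
    have h2 : T.jost z k *ᵥ x = 0 := by
      rw [← hT.fundSol_mul_jost k hz0 hl, ← Matrix.mulVec_mulVec, hx, Matrix.mulVec_zero]
    rw [jost, Matrix.smul_mulVec] at h2
    exact (smul_eq_zero.1 h2).resolve_left (pow_ne_zero k hβ)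
  have hcont : Continuous fun Y : Matrix (Fin m₁ ⊕ Fin m₂) (Fin m₂) ℂ => Y *ᵥ x := by fun_prop
  have h2 := (hcont.tendsto _).comp (hT.tendsto_transfer hl)
  have h3 : lastCols m₁ m₂ *ᵥ x = 0 :=
    tendsto_nhds_unique h2 (tendsto_const_nhds.congr fun k => (h1 k).symm)
  rw [Matrix.fromRows_mulVec, Matrix.one_mulVec] at h3
  ext i
  exact congrFun h3 (Sum.inr i)

/-- Off `z = i`, the decaying solutions form a space of dimension at most `m₂`, because the form
`y^* C_k y` is negative on it; the Jost solutions fill this space. -/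
theorem StronglyAdmissible.exists_of_tendsto_of_ne (hT : T.StronglyAdmissible) {z : ℂ}
    (hz : 1 / 2 < z.im) (hzI : z ≠ Complex.I) {g : Fin m₁ ⊕ Fin m₂ → ℂ}
    (hg : Tendsto (fun k => fundSol T.potential z k *ᵥ g) atTop (𝓝 0)) :
    ∃ x, g = T.jost z 0 *ᵥ x := by
  have hz0 : z ≠ 0 := by rintro rfl; norm_num at hz
  have hzim : 0 < z.im := by linarith
  have hl : IsUnit (T.A - (-z) • 1) := hT.isUnit_sub (by rw [Complex.neg_im]; linarith)
  have hβ : 1 - Complex.I / z ≠ 0 := by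
    rw [sub_ne_zero]
    exact fun h => hzI ((eq_div_iff hz0).1 h ▸ (one_mul z).symm)
  have hc : 0 < (Complex.I / z).re := by
    rw [I_div_re]
    have := norm_pos_iff.2 hz0
    positivity
  obtain ⟨K, hK⟩ := hT.exists_small_steps
    (ε := 2 * (Complex.I / z).re / (1 + ‖Complex.I / z‖ ^ 2)) (by positivity)
  obtain ⟨U, -, hU⟩ := hT.isDiracPotential K
  set N := (lastCols m₁ m₂)ᴴ * U * fundSol T.potential z K with hN
  have hker : ∀ h : Fin m₁ ⊕ Fin m₂ → ℂ,
      Tendsto (fun k => fundSol T.potential z k *ᵥ h) atTop (𝓝 0) → N *ᵥ h = 0 → h = 0 := by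
    intro h hh hNh
    set w := U *ᵥ (fundSol T.potential z K *ᵥ h) with hw
    have hw2 : ∀ i, w (Sum.inr i) = 0 := by
      intro i
      have h1 := congrFun hNh i
      rw [hN, ← Matrix.mulVec_mulVec, ← Matrix.mulVec_mulVec, ← hw] at h1
      simpa [Matrix.mulVec, dotProduct, Matrix.one_apply] using h1
    have hJw : sigJ m₁ m₂ *ᵥ w = w := by
      ext i
      rw [sigJ_eq_diagonal, Matrix.mulVec_diagonal]
      rcases i with i | i
      · simp
      · simp [hw2 i]
    have hq : quadRe (T.potential K) (fundSol T.potential z K *ᵥ h) = normSq w := by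
      rw [quadRe, hU, ← Matrix.mulVec_mulVec, ← Matrix.mulVec_mulVec, ← hw, hJw,
        Matrix.dotProduct_mulVec, ← Matrix.star_mulVec, ← hw, star_dotProduct_self,
        Complex.ofReal_re]
    have h2 := fundSol_mulVec_eq_zero hT.potential_conjTranspose hT.potential_mul_self hzim hK hh
      le_rfl (by rw [hq]; exact normSq_nonneg _)
    have h3 := le_normSq_fundSol hT.potential_conjTranspose hT.potential_mul_self hzim.le K h
    rw [h2, normSq_zero] at h3
    have h4 : 0 < ‖(1 - Complex.I / z) ^ K‖ ^ 2 := by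
      have := norm_pos_iff.2 (pow_ne_zero K hβ)
      positivity
    refine normSq_eq_zero.1 (le_antisymm ?_ (normSq_nonneg _))
    by_contra hcon
    exact h3.not_gt (mul_pos h4 (not_le.1 hcon))
  have hunit : IsUnit (N * T.jost z 0) := by
    rw [← Matrix.mulVec_injective_iff_isUnit]
    intro x y hxy
    rw [← sub_eq_zero, ← Matrix.mulVec_sub, ← Matrix.mulVec_mulVec] at hxy
    exact sub_eq_zero.1 (hT.eq_zero_of_jost_mulVec hz0 hzI hl
      (hker _ (hT.tendsto_jost_mulVec hz _) hxy))
  have hdet := (Matrix.isUnit_iff_isUnit_det _).1 hunit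
  refine ⟨(N * T.jost z 0)⁻¹ *ᵥ (N *ᵥ g), sub_eq_zero.1 (hker _ ?_ ?_)⟩
  · have := hg.sub (hT.tendsto_jost_mulVec hz ((N * T.jost z 0)⁻¹ *ᵥ (N *ᵥ g)))
    simpa only [Matrix.mulVec_sub, sub_zero] using this
  · rw [Matrix.mulVec_sub, Matrix.mulVec_mulVec _ N, Matrix.mulVec_mulVec _ (N * _),
      Matrix.mul_nonsing_inv _ hdet, Matrix.one_mulVec, sub_self]

/-- At `z = i` the coefficients `I + C_k` are singular, but `w_A(0, -i)` is invertible because `i`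
is not an eigenvalue of `A`, and decaying solutions vanish identically from some index on. -/
theorem StronglyAdmissible.exists_of_tendsto_I (hT : T.StronglyAdmissible)
    {g : Fin m₁ ⊕ Fin m₂ → ℂ}
    (hg : Tendsto (fun k => fundSol T.potential Complex.I k *ᵥ g) atTop (𝓝 0)) :
    ∃ x, g = T.jost Complex.I 0 *ᵥ x := by
  have hII : Complex.I / Complex.I = 1 := div_self Complex.I_ne_zero
  have hl : IsUnit (T.A - (-Complex.I) • 1) := hT.isUnit_sub (by simp)
  have hl' : IsUnit (T.A - Complex.I • 1) := notMem_spectrum_iff.1 hT.not_mem_spectrum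
  have hW : ∀ k, T.transfer k (-Complex.I) * (T.transfer k Complex.I)ᴴ = 1 := fun k =>
    hT.transfer_mul_conjTranspose k (by simp) hl hl'
  have hW' : ∀ k, (T.transfer k Complex.I)ᴴ * T.transfer k (-Complex.I) = 1 := fun k =>
    mul_eq_one_comm.1 (hW k)
  obtain ⟨K, hK⟩ := hT.exists_small_steps
    (ε := 2 * (Complex.I / Complex.I).re / (1 + ‖Complex.I / Complex.I‖ ^ 2)) (by
      rw [hII]; norm_num)
  have h0 : 0 ≤ quadRe (T.potential (K + 1)) (fundSol T.potential Complex.I (K + 1) *ᵥ g) := by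
    have h := le_quadRe_succ hT.potential_conjTranspose hT.potential_mul_self K (hK K le_rfl)
      (fundSol T.potential Complex.I K *ᵥ g)
    rw [← fundSol_succ_mulVec, hII] at h
    norm_num at h
    exact h
  have h1 := fundSol_mulVec_eq_zero hT.potential_conjTranspose hT.potential_mul_self
    (z := Complex.I) (by simp) hK hg K.le_succ h0
  set h := (T.transfer 0 Complex.I)ᴴ *ᵥ g with hh
  have hgh : g = T.transfer 0 (-Complex.I) *ᵥ h := by
    rw [hh, Matrix.mulVec_mulVec, hW, Matrix.one_mulVec]
  have h2 : (1 + sigJ m₁ m₂) ^ (K + 1) *ᵥ h = 0 := by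
    rw [hgh, Matrix.mulVec_mulVec, hT.fundSol_mul_transfer _ Complex.I_ne_zero hl, hII,
      one_smul] at h1
    have h3 := congrArg ((T.transfer (K + 1) Complex.I)ᴴ *ᵥ ·) h1
    simpa only [Matrix.mulVec_mulVec, ← Matrix.mul_assoc, hW', Matrix.one_mul,
      Matrix.mulVec_zero] using h3
  have h3 : ∀ i, h (Sum.inl i) = 0 := by
    intro i
    have h4 : (1 + sigJ m₁ m₂) =
        Matrix.diagonal fun i => 1 + Sum.elim (fun _ => (1 : ℂ)) (fun _ => -1) i := by
      rw [sigJ_eq_diagonal, ← Matrix.diagonal_one, Matrix.diagonal_add]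
    rw [h4, Matrix.diagonal_pow] at h2
    have h5 := congrFun h2 (Sum.inl i)
    rw [Matrix.mulVec_diagonal] at h5
    simp only [Pi.pow_apply, Sum.elim_inl, Pi.zero_apply] at h5
    exact (mul_eq_zero.1 h5).resolve_left (pow_ne_zero _ (by norm_num))
  refine ⟨fun i => h (Sum.inr i), ?_⟩
  rw [hgh, jost, pow_zero, one_smul, ← Matrix.mulVec_mulVec, Matrix.fromRows_mulVec]
  congr 1
  ext i
  rcases i with i | i
  · simp [h3 i]
  · simp

theorem StronglyAdmissible.exists_of_tendsto (hT : T.StronglyAdmissible) {z : ℂ}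
    (hz : 1 / 2 < z.im) {g : Fin m₁ ⊕ Fin m₂ → ℂ}
    (hg : Tendsto (fun k => fundSol T.potential z k *ᵥ g) atTop (𝓝 0)) :
    ∃ x, g = T.jost z 0 *ᵥ x := by
  by_cases hzI : z = Complex.I
  · subst hzI
    exact hT.exists_of_tendsto_I hg
  · exact hT.exists_of_tendsto_of_ne hz hzI hg

theorem StronglyAdmissible.weyl_unique (hT : T.StronglyAdmissible) (hm₂ : 0 < m₂) {M : ℝ}
    {φ : ℂ → Matrix (Fin m₁) (Fin m₂) ℂ} (h : IsWeylFunction T.potential M φ) {z : ℂ}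
    (hz : M < z.im) : IsUnit (T.d (-z)) ∧ φ z = T.b (-z) * (T.d (-z))⁻¹ := by
  have hM := h.half_le hT.potential_conjTranspose hT.potential_mul_self hm₂
  choose x hx using fun l => hT.exists_of_tendsto (hM.trans_lt hz) (h.tendsto hz l)
  set X : Matrix (Fin m₂) (Fin m₂) ℂ := Matrix.of fun i l => x l i with hX
  have h1 : Matrix.fromRows (φ z) 1 = Matrix.fromRows (T.b (-z)) (T.d (-z)) * X := by
    rw [← jost_zero]
    ext i l
    exact congrFun (hx l) i
  rw [Matrix.fromRows_mul] at h1
  obtain ⟨h2, h3⟩ := (Matrix.fromRows_ext_iff _ _ _ _).1 h1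
  have hd : IsUnit (T.d (-z)) := IsUnit.of_mul_eq_one X h3.symm
  refine ⟨hd, ?_⟩
  rw [h2, Matrix.inv_eq_right_inv h3.symm]

/-- In `Im z > 1/2` the factor `1 - i/z` is less than one in absolute value, so that the Jost
solution decays geometrically. -/
theorem StronglyAdmissible.summable_weyl (hT : T.StronglyAdmissible) {z : ℂ} (hz : 1 / 2 < z.im)
    (hd : IsUnit (T.d (-z))) :
    Summable fun k : ℕ =>
      (Matrix.fromRows (T.b (-z) * (T.d (-z))⁻¹) (1 : Matrix (Fin m₂) (Fin m₂) ℂ))ᴴ *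
        (fundSol T.potential z k)ᴴ * fundSol T.potential z k *
          Matrix.fromRows (T.b (-z) * (T.d (-z))⁻¹) (1 : Matrix (Fin m₂) (Fin m₂) ℂ) := by
  have hz0 : z ≠ 0 := by rintro rfl; norm_num at hz
  have hl : IsUnit (T.A - (-z) • 1) := hT.isUnit_sub (by rw [Complex.neg_im]; linarith)
  have hdu := (Matrix.isUnit_iff_isUnit_det _).1 hd
  set β := 1 - Complex.I / z with hβ
  have hβ1 : ‖β‖ < 1 := norm_one_sub_I_div_lt_one hz
  set W : ℕ → Matrix (Fin m₁ ⊕ Fin m₂) (Fin m₂) ℂ := fun k =>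
    T.transfer k (-z) * lastCols m₁ m₂ * (T.d (-z))⁻¹ with hW
  have h0 : Matrix.fromRows (T.b (-z) * (T.d (-z))⁻¹) (1 : Matrix (Fin m₂) (Fin m₂) ℂ) =
      T.jost z 0 * (T.d (-z))⁻¹ := by
    rw [jost_zero, Matrix.fromRows_mul, Matrix.mul_nonsing_inv _ hdu]
  have h1 : ∀ k, fundSol T.potential z k *
      Matrix.fromRows (T.b (-z) * (T.d (-z))⁻¹) (1 : Matrix (Fin m₂) (Fin m₂) ℂ) =
      β ^ k • W k := by
    intro k
    rw [h0, ← Matrix.mul_assoc, hT.fundSol_mul_jost k hz0 hl, jost, Matrix.smul_mul]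
  have h2 : ∀ k, (Matrix.fromRows (T.b (-z) * (T.d (-z))⁻¹) (1 : Matrix (Fin m₂) (Fin m₂) ℂ))ᴴ *
        (fundSol T.potential z k)ᴴ * fundSol T.potential z k *
          Matrix.fromRows (T.b (-z) * (T.d (-z))⁻¹) (1 : Matrix (Fin m₂) (Fin m₂) ℂ) =
      (star (β ^ k) * β ^ k) • ((W k)ᴴ * W k) := by
    intro k
    rw [← Matrix.conjTranspose_mul, Matrix.mul_assoc, h1, Matrix.conjTranspose_smul,
      Matrix.smul_mul, Matrix.mul_smul, smul_smul]
  simp only [h2]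
  have hWlim : Tendsto (fun k => (W k)ᴴ * W k) atTop
      (𝓝 ((lastCols m₁ m₂ * (T.d (-z))⁻¹)ᴴ * (lastCols m₁ m₂ * (T.d (-z))⁻¹))) := by
    have hcont : Continuous fun Y : Matrix (Fin m₁ ⊕ Fin m₂) (Fin m₂) ℂ =>
        (Y * (T.d (-z))⁻¹)ᴴ * (Y * (T.d (-z))⁻¹) := by fun_prop
    exact (hcont.tendsto _).comp (hT.tendsto_transfer hl)
  refine Pi.summable.2 fun i => Pi.summable.2 fun l => ?_
  refine summable_of_isBigO_nat (g := fun k => (‖β‖ ^ 2) ^ k)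
    (summable_geometric_of_lt_one (by positivity) ((sq_lt_one_iff₀ (norm_nonneg _)).2 hβ1)) ?_
  have h3 : (fun k => ((W k)ᴴ * W k) i l) =O[atTop] fun _ => (1 : ℝ) :=
    (tendsto_pi_nhds.1 (tendsto_pi_nhds.1 hWlim i) l).isBigO_one ℝ
  have h4 : (fun k => star (β ^ k) * β ^ k) =O[atTop] fun k => (‖β‖ ^ 2) ^ k := by
    refine Asymptotics.isBigO_of_le _ fun k => ?_
    rw [norm_mul, norm_star, norm_pow, Real.norm_of_nonneg (by positivity), ← mul_pow, sq]
  simpa using h4.mul h3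

end Triple

end SkewDirac

theorem theorem3p3 (m₁ m₂ n : ℕ) (hm₁ : 0 < m₁) (hm₂ : 0 < m₂) (hn : 0 < n)
    (T : SkewDirac.Triple m₁ m₂ n) (hT : T.StronglyAdmissible) :
    -- the potential is well defined, and the system is a skew-self-adjoint Dirac system
    (IsUnit T.A ∧ (∀ k, (T.S k).PosDef) ∧ SkewDirac.IsDiracPotential T.potential) ∧
    -- `b(-z) d(-z)⁻¹` is defined for all but finitely many `z`
    {z : ℂ | -z ∈ spectrum ℂ T.A ∨ ¬ IsUnit (T.d (-z))}.Finite ∧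
    ∃ F : Matrix (Fin m₁) (Fin m₂) (RatFunc ℂ),
      -- the rational matrix function `F` is `b(-z) d(-z)⁻¹`
      (∀ z : ℂ, -z ∉ spectrum ℂ T.A → IsUnit (T.d (-z)) →
        SkewDirac.RegularAt F z ∧ SkewDirac.ratEval F z = T.b (-z) * (T.d (-z))⁻¹) ∧
      -- the reflection coefficient is given by `F`
      (∀ z : ℂ, 0 ≤ z.im → z ≠ 0 → z ≠ Complex.I →
        -z ∉ spectrum ℂ T.A ∧
        (∃! Y, SkewDirac.IsJostSolution T.potential z Y) ∧
        ∀ ρ, SkewDirac.IsReflectionValue T.potential z ρ ↔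
          IsUnit (T.d (-z)) ∧ ρ = SkewDirac.ratEval F z) ∧
      -- `F` is a Weyl function in some half-plane
      (∃ M : ℝ, (∀ z : ℂ, M < z.im → -z ∉ spectrum ℂ T.A ∧ IsUnit (T.d (-z))) ∧
        SkewDirac.IsWeylFunction T.potential M (SkewDirac.ratEval F)) ∧
      -- and every Weyl function is given by `F`
      (∀ (M : ℝ) (φ : ℂ → Matrix (Fin m₁) (Fin m₂) ℂ),
        SkewDirac.IsWeylFunction T.potential M φ →
          ∀ z : ℂ, M < z.im →
            -z ∉ spectrum ℂ T.A ∧ IsUnit (T.d (-z)) ∧ φ z = SkewDirac.ratEval F z) := by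
  have hspec : ∀ z : ℂ, 0 ≤ z.im → -z ∉ spectrum ℂ T.A := fun z hz h => by
    have := hT.im_pos h
    rw [Complex.neg_im] at this
    linarith
  have hfin := SkewDirac.Triple.finite_exceptional T
  obtain ⟨F, hF⟩ := SkewDirac.Triple.exists_rational T
  refine ⟨⟨hT.isUnit_A, hT.S_posDef, hT.isDiracPotential⟩, hfin, F, hF, ?_, ?_, ?_⟩
  · intro z hz hz0 hzI
    have hl := SkewDirac.notMem_spectrum_iff.1 (hspec z hz)
    have hJ := hT.isJostSolution_jost hz0 hl
    have huniq : ∀ Y, SkewDirac.IsJostSolution T.potential z Y → Y = T.jost z := fun Y hY =>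
      hY.unique hT.potential_conjTranspose hT.potential_mul_self hz hz0 hzI hJ
    refine ⟨hspec z hz, ⟨_, hJ, huniq⟩, fun ρ => ⟨?_, ?_⟩⟩
    · rintro ⟨Y, hY, hu, rfl⟩
      rw [huniq Y hY, SkewDirac.Triple.jost_zero, Matrix.toRows₂_fromRows] at hu
      rw [huniq Y hY, SkewDirac.Triple.jost_zero, Matrix.toRows₂_fromRows,
        Matrix.toRows₁_fromRows, (hF z (hspec z hz) hu).2]
      exact ⟨hu, rfl⟩
    · rintro ⟨hu, rfl⟩
      refine ⟨_, hJ, ?_, ?_⟩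
      · rw [SkewDirac.Triple.jost_zero, Matrix.toRows₂_fromRows]
        exact hu
      · rw [SkewDirac.Triple.jost_zero, Matrix.toRows₂_fromRows, Matrix.toRows₁_fromRows,
          (hF z (hspec z hz) hu).2]
  · obtain ⟨M, hM⟩ := (hfin.image Complex.im).bddAbove
    have hreg : ∀ z : ℂ, max M 1 < z.im → -z ∉ spectrum ℂ T.A ∧ IsUnit (T.d (-z)) := by
      intro z hz
      by_contra hcon
      have hmem : z ∈ {z : ℂ | -z ∈ spectrum ℂ T.A ∨ ¬ IsUnit (T.d (-z))} := by
        rw [Set.mem_ofPred_eq]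
        tauto
      exact ((le_max_left M 1).trans_lt hz).not_ge (hM (Set.mem_image_of_mem _ hmem))
    refine ⟨max M 1, hreg, lt_of_lt_of_le one_pos (le_max_right M 1), fun z hz => ?_⟩
    obtain ⟨h1, h2⟩ := hreg z hz
    rw [(hF z h1 h2).2]
    exact hT.summable_weyl (by linarith [le_max_right M 1]) h2
  · intro M φ hφ z hz
    obtain ⟨h1, h2⟩ := hT.weyl_unique hm₂ hφ hz
    have h3 := hspec z (hφ.1.trans hz).le
    exact ⟨h3, h1, by rw [h2, (hF z h3 h1).2]⟩
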